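/- Let $f_1,\dots,f_m:\mathbb R^n\to\mathbb R$ ($m\ge 1$) be $C^1$ with $L_i$-Lipschitz gradients, $F=\frac1m\sum_i f_i$, $L=\max_i L_i$, let $R:\mathbb R^n\to\mathbb R\cup\{+\infty\}$ be proper, convex and lower semicontinuous, and let $\Phi=R+F$. On a probability space consider the perturbed Forward–Backward iteration $$x_{k+1}=\operatorname{prox}_{\gamma_kR}\bigl(x_k-\gamma_k(\nabla F(x_k)+\varepsilon_k)\bigr),\qquad k\ge 0,$$ with deterministic step-sizes $\gamma_k>0$ and random errors $\varepsilon_k\in\mathbb R^n$. Suppose that $\liminf_k\gamma_k\ge\underline\gamma$ for some $\underline\gamma>0$; that $\varepsilon_k\to0$ almost surely; and that there is a (deterministic) $x^\star\in\operatorname{Argmin}\Phi$ with $x_k\to x^\star$ almost surely. Suppose also that $-\nabla F(x^\star)\in\operatorname{ri}\partial R(x^\star)$ and that $R$ is partly smooth at $x^\star$ relative to a set $\mathcal M\ni x^\star$. The latter means: $\partial R(x^\star)\ne\emptyset$; $\mathcal M$ is a $C^2$ embedded submanifold of $\mathbb R^n$ around $x^\star$ and $R|_{\mathcal M}$ is $C^2$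 around $x^\star$; the tangent space $T$ of $\mathcal M$ at $x^\star$ is the orthogonal complement of the linear subspace parallel to the affine hull of $\partial R(x^\star)$; and $\partial R$ is continuous at $x^\star$ relative to $\mathcal M$ (as a set-valued map). Then almost surely $x_k\to x^\star$ and $x_k\in\mathcal M$ for all large $k$. If moreover $F$ is $C^2$ in a neighbourhood of $x^\star$ and $\gamma_k\to\gamma\in\,]0,1/L[$ (with $1/0=+\infty$), let $P_T$ be the orthogonal projection onto $T$ and let $\nabla^2_{\mathcal M}\Phi(x^\star)$ be the Riemannian Hessian of $\Phi$ along $\mathcal M$, i.e. $h\mapsto P_T\,\mathrm d(\nabla_{\mathcal M}\Phi)(x^\star)[h]$ on $T$, where $\nabla_{\mathcal M}\Phi(y)\in T_y\mathcal M$ is the Riemannian gradient. Put $$H_F=P_T\nabla^2F(x^\star)P_T,\quad H_R=\nabla^2_{\mathcal M}\Phi(x^\star)P_T-H_F,\quad W_R=(\mathrm{Id}+\gamma H_R)^{-1},\quad M_{FB}=W_R(\mathrm{Id}-\gamma H_F).$$ Then $\mathrm{Id}+\gamma H_R$ is invertible, and with probability one there exists $K\in\mathbb N$ such that, for all $k\ge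 K$, $$d_{k+1}=M_{FB}\,d_k+\varphi_k,\qquad d_k=x_k-x^\star+o(\|x_k-x^\star\|),\quad \varphi_k=-\gamma W_RP_T\varepsilon_k+o(\|\varepsilon_k\|),$$ where, as usual for Landau symbols, the $o$-terms in the left-hand $d_{k+1}$ and in the right-hand $d_k$ need not come from the same sequence. That is: for every sequence $(d_k)$ with $d_k=x_k-x^\star+o(\|x_k-x^\star\|)$ there are sequences $(\tilde d_k)$ with $\tilde d_k=x_k-x^\star+o(\|x_k-x^\star\|)$ and $(\varphi_k)$ with $\varphi_k=-\gamma W_RP_T\varepsilon_k+o(\|\varepsilon_k\|)$ such that $d_{k+1}=M_{FB}\tilde d_k+\varphi_k$ for all $k\ge K$. -/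

import Mathlib

open Filter Topology MeasureTheory Asymptotics
open scoped NNReal

noncomputable section

namespace PerturbedFB

/-- The Euclidean space `ℝⁿ`. -/
abbrev Eucl (n : ℕ) : Type := EuclideanSpace ℝ (Fin n)

variable {n : ℕ}

/-- `R : ℝⁿ → ℝ ∪ {+∞}` is proper: it never takes the value `-∞` and is finite somewhere. -/
def IsProperFun (R : Eucl n → EReal) : Prop :=
  (∀ x, R x ≠ ⊥) ∧ ∃ x, R x ≠ ⊤

/-- An extended-real-valued function is convex when its epigraph is convex. -/
def IsConvexFun (R : Eucl n → EReal) : Prop :=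
  Convex ℝ {p : Eucl n × ℝ | R p.1 ≤ (p.2 : EReal)}

/-- The subdifferential of convex analysis. -/
def subdifferential (R : Eucl n → EReal) (x : Eucl n) : Set (Eucl n) :=
  {v | ∀ y, R x + ((inner ℝ v (y - x) : ℝ) : EReal) ≤ R y}

/-- `p = prox_{γ R}(y)`: the point `p` minimises `γ R(z) + ½ ‖z - y‖²` over `z`. For `γ > 0` and `R`
proper, convex and lower semicontinuous this minimiser exists and is unique. -/
def IsProx (γ : ℝ) (R : Eucl n → EReal) (y p : Eucl n) : Prop :=
  IsMinOn (fun z => (γ : EReal) * R z + ((1 / 2 * ‖z - y‖ ^ 2 : ℝ) : EReal)) Set.univ p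

/-- The average `F = (1/m) ∑ᵢ fᵢ`. -/
def average {m : ℕ} (f : Fin m → Eucl n → ℝ) (x : Eucl n) : ℝ :=
  (1 / (m : ℝ)) * ∑ i, f i x

/-- The objective `Φ = R + F`. -/
def objective (R : Eucl n → EReal) (F : Eucl n → ℝ) (x : Eucl n) : EReal :=
  R x + (F x : EReal)

/-- `M` is a `C²`-smooth embedded submanifold of `ℝⁿ` around its point `x`: near `x` it is the zero
set of a `C²` map whose derivative at `x` is surjective. -/
def IsC2ManifoldAround (M : Set (Eucl n)) (x : Eucl n) : Prop :=
  x ∈ M ∧ ∃ (d : ℕ) (g : Eucl n → Eucl d), ContDiffAt ℝ 2 g x ∧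
    Function.Surjective (fderiv ℝ g x) ∧ ∀ᶠ y in 𝓝 x, (y ∈ M ↔ g y = 0)

/-- The tangent space of `M` at `x`, as a subspace of `ℝⁿ`. At a point around which `M` is a
manifold, the tangent cone is already a subspace, and the span changes nothing. -/
def tangentSpaceAt (M : Set (Eucl n)) (x : Eucl n) : Submodule ℝ (Eucl n) :=
  Submodule.span ℝ (tangentConeAt ℝ M x)

/-- The orthogonal projection of `ℝⁿ` onto the tangent space of `M` at `x`. -/
def tangentProj (M : Set (Eucl n)) (x : Eucl n) : Eucl n →L[ℝ] Eucl n :=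
  (tangentSpaceAt M x).starProjection

/-- Continuity at `x` relative to `M` of the set-valued map `S`, in the sense of
Painlevé–Kuratowski: inner semicontinuity and outer semicontinuity. -/
def SetValuedContinuousWithinAt (S : Eucl n → Set (Eucl n)) (M : Set (Eucl n)) (x : Eucl n) :
    Prop :=
  (∀ v ∈ S x, ∀ r > (0 : ℝ), ∀ᶠ y in 𝓝[M] x, ∃ w ∈ S y, dist w v < r) ∧
  (∀ v, (∀ r > (0 : ℝ), ∃ᶠ y in 𝓝[M] x, ∃ w ∈ S y, dist w v < r) → v ∈ S x)

/-- `R` is partly smooth at `x` relative to `M`. -/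
structure PartlySmooth (R : Eucl n → EReal) (M : Set (Eucl n)) (x : Eucl n) : Prop where
  nonempty : (subdifferential R x).Nonempty
  manifold : IsC2ManifoldAround M x
  /-- the restriction of `R` to `M` is `C²` around `x`: it has a `C²` local representative -/
  smooth : ∃ G : Eucl n → ℝ, ContDiffAt ℝ 2 G x ∧ ∀ᶠ y in 𝓝[M] x, R y = (G y : EReal)
  /-- `vectorSpan` is the subspace parallel to the affine hull -/
  sharp : tangentSpaceAt M x = (vectorSpan ℝ (subdifferential R x))ᗮ
  continuous : SetValuedContinuousWithinAt (subdifferential R) M x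

/-- The Riemannian (covariant) gradient of `G` along `M` at `y`: the tangential part of a gradient of
`G` within `M`. The tangential part does not depend on which gradient within `M` is taken, and it is
`P_{T_y M} ∇G̃(y)` for any smooth representative `G̃` of `G` on `M`. -/
def riemannianGradient (G : Eucl n → ℝ) (M : Set (Eucl n)) (y : Eucl n) : Eucl n :=
  tangentProj M y (gradientWithin G M y)

/-- The Riemannian (covariant) Hessian of `G` along `M` at `x`, extended by zero on the normal space:
`h ↦ P_T d(∇_M G)(x)[P_T h]`, where `T` is the tangent space at `x` and the differential is taken
along `M`. -/
def riemannianHessian (G : Eucl n → ℝ) (M : Set (Eucl n)) (x : Eucl n) : Eucl n →L[ℝ] Eucl n :=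
  tangentProj M x ∘L fderivWithin ℝ (riemannianGradient G M) M x ∘L tangentProj M x

/-- `H_F = P_T ∇²F(x) P_T`. -/
def HF (F : Eucl n → ℝ) (M : Set (Eucl n)) (x : Eucl n) : Eucl n →L[ℝ] Eucl n :=
  tangentProj M x ∘L fderiv ℝ (gradient F) x ∘L tangentProj M x

/-- `H_R = ∇²_M Φ(x) P_T - H_F`, where `Φ = R + F`. -/
def HR (R : Eucl n → EReal) (F : Eucl n → ℝ) (M : Set (Eucl n)) (x : Eucl n) :
    Eucl n →L[ℝ] Eucl n :=
  riemannianHessian (fun y => (objective R F y).toReal) M x - HF F M x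

/-- `G_F = Id - γ H_F`. -/
def GF (γ : ℝ) (F : Eucl n → ℝ) (M : Set (Eucl n)) (x : Eucl n) : Eucl n →L[ℝ] Eucl n :=
  ContinuousLinearMap.id ℝ (Eucl n) - γ • HF F M x

/-- `W_R = (Id + γ H_R)⁻¹`. -/
def WR (γ : ℝ) (R : Eucl n → EReal) (F : Eucl n → ℝ) (M : Set (Eucl n)) (x : Eucl n) :
    Eucl n →L[ℝ] Eucl n :=
  (ContinuousLinearMap.id ℝ (Eucl n) + γ • HR R F M x).inverse

/-- `M_FB = W_R G_F`. -/
def MFB (γ : ℝ) (R : Eucl n → EReal) (F : Eucl n → ℝ) (M : Set (Eucl n)) (x : Eucl n) :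
    Eucl n →L[ℝ] Eucl n :=
  WR γ R F M x ∘L GF γ F M x

end PerturbedFB

end

namespace PerturbedFB

variable {n : ℕ}

/-! Identification. The proximal step makes `v_k = γ_k⁻¹(x_k - x_{k+1}) - ∇F(x_k) - ε_k` a
subgradient of `R` at `x_{k+1}`, and `v_k → u = -∇F(x⋆)` because the step-sizes are bounded below.
If infinitely many iterates were off `M`, the unit vectors pointing to them from their retractions
on `M` would accumulate at a unit `ν ∈ Tᗮ`. By sharpness `Tᗮ` is parallel to the affine hull of
`∂R(x⋆)`, so `u + tν ∈ ∂R(x⋆)` for small `t > 0`. Inner semicontinuity along `M` gives nearby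
subgradients at the retracted points, and these contradict monotonicity of `∂R`
(`PartlySmooth.eventually_mem`).

Linearisation. Let `Ψ` be a local `C²` retraction onto `M` with fibres parallel to `Tᗮ`, `G` a `C²`
representative of `R` on `M`, `c = ∇F(x⋆)` and `q = G ∘ Ψ + ⟪c, Ψ⟫`. On `M` near `x⋆`, `∇q(y) =
DΨ(y)*(v + c)` for every `v ∈ ∂R(y)`, so applying `DΨ(x_{k+1})*` to the inclusion gives an equation
between smooth quantities. Since `DΨ(x⋆) = P_T`, expanding at `x⋆` yields `(Id + γ ∇²q P_T)(x_{k+1}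
- x⋆) = (Id - γ H_F)(x_k - x⋆) - γ P_T ε_k` up to small terms. `HR_eq` identifies `∇²q(x⋆) P_T` with
`H_R`; as `x⋆` is a local minimum of `q`, `∇²q(x⋆) ≥ 0` and `Id + γ H_R` is invertible. Finally `γL
< 1` makes `M_FB` invertible, so the remainder can be shared between `d̃_k` and `φ_k`
(`exists_perturbed_recursion`). -/

/-! ### Convex analysis: subgradients, the proximal step, the relative interior -/

lemma IsProperFun.exists_eq_coe {R : Eucl n → EReal} (hR : IsProperFun R) {x v : Eucl n}
    (hv : v ∈ subdifferential R x) : ∃ a : ℝ, R x = a := by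
  obtain ⟨hbot, x₀, hx₀⟩ := hR
  have htop : R x ≠ ⊤ := by
    intro h
    have := hv x₀
    rw [h, EReal.top_add_coe, top_le_iff] at this
    exact hx₀ this
  exact ⟨(R x).toReal, (EReal.coe_toReal htop (hbot x)).symm⟩

lemma subdifferential_monotone {R : Eucl n → EReal} (hR : IsProperFun R) {x y v w : Eucl n}
    (hv : v ∈ subdifferential R x) (hw : w ∈ subdifferential R y) :
    0 ≤ inner ℝ (v - w) (x - y) := by
  obtain ⟨a, ha⟩ := hR.exists_eq_coe hv
  obtain ⟨b, hb⟩ := hR.exists_eq_coe hw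
  have h1 := hv y
  have h2 := hw x
  rw [ha, hb] at h1 h2
  have h1' : a + inner ℝ v (y - x) ≤ b := by exact_mod_cast h1
  have h2' : b + inner ℝ w (x - y) ≤ a := by exact_mod_cast h2
  rw [inner_sub_left]
  rw [← neg_sub x y, inner_neg_right] at h1'
  linarith

lemma nonneg_of_forall_mul_add_sq {a b : ℝ} (h : ∀ s : ℝ, 0 < s → s ≤ 1 → 0 ≤ s * a + s ^ 2 * b) :
    0 ≤ a := by
  have ht : Tendsto (fun s : ℝ => a + s * b) (𝓝[>] 0) (𝓝 (a + 0 * b)) :=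
    Tendsto.mono_left (Continuous.tendsto (by fun_prop) 0) nhdsWithin_le_nhds
  rw [zero_mul, add_zero] at ht
  refine ge_of_tendsto ht ?_
  filter_upwards [Ioc_mem_nhdsGT (zero_lt_one' ℝ)] with s hs
  have := h s hs.1 hs.2
  by_contra! hc
  nlinarith [mul_pos hs.1 (neg_pos.2 hc)]

/-- Compare `p` with `p + s(z - p)`, bound `R` there by convexity, and keep the first-order term as
`s → 0`. -/
lemma IsProx.mem_subdifferential {R : Eucl n → EReal} (hR : IsProperFun R) (hRc : IsConvexFun R)
    {γ : ℝ} (hγ : 0 < γ) {y p : Eucl n} (h : IsProx γ R y p) :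
    γ⁻¹ • (y - p) ∈ subdifferential R p := by
  have hmin : ∀ z, (γ : EReal) * R p + ((1 / 2 * ‖p - y‖ ^ 2 : ℝ) : EReal) ≤
      (γ : EReal) * R z + ((1 / 2 * ‖z - y‖ ^ 2 : ℝ) : EReal) := fun z => h (Set.mem_univ z)
  have hreal : ∀ z, R z ≠ ⊤ → ∃ b : ℝ, R z = b := fun z hz =>
    ⟨(R z).toReal, (EReal.coe_toReal hz (hR.1 z)).symm⟩
  obtain ⟨a, ha⟩ : ∃ a : ℝ, R p = a := by
    apply hreal
    intro htop
    obtain ⟨x₀, hx₀⟩ := hR.2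
    obtain ⟨b, hb⟩ := hreal x₀ hx₀
    have := hmin x₀
    rw [htop, hb, EReal.coe_mul_top_of_pos hγ, EReal.top_add_coe, top_le_iff] at this
    exact EReal.coe_ne_top (γ * b + (1 / 2 * ‖x₀ - y‖ ^ 2)) (by exact_mod_cast this)
  intro z
  by_cases hz : R z = ⊤
  · rw [hz]; exact le_top
  obtain ⟨b, hb⟩ := hreal z hz
  rw [ha, hb]
  norm_cast
  have key : 0 ≤ γ * (b - a) + inner ℝ (p - y) (z - p) := by
    apply nonneg_of_forall_mul_add_sq (b := 1 / 2 * ‖z - p‖ ^ 2)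
    intro s hs0 hs1
    have hmem : ((1 - s) • ((p, a) : Eucl n × ℝ) + s • ((z, b) : Eucl n × ℝ)) ∈
        {q : Eucl n × ℝ | R q.1 ≤ (q.2 : EReal)} :=
      hRc (by simp [ha]) (by simp [hb]) (by linarith) hs0.le (by ring)
    have hpt : (1 - s) • p + s • z = p + s • (z - p) := by module
    simp only [Set.mem_ofPred_eq, Prod.fst_add, Prod.smul_fst, Prod.snd_add, Prod.smul_snd,
      smul_eq_mul, hpt] at hmem
    obtain ⟨c, hc⟩ := hreal (p + s • (z - p)) (ne_top_of_le_ne_top (EReal.coe_ne_top _) hmem)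
    have h1 := hmin (p + s • (z - p))
    rw [hc, ha] at h1
    rw [hc] at hmem
    have h1' : γ * a + 1 / 2 * ‖p - y‖ ^ 2 ≤ γ * c + 1 / 2 * ‖p + s • (z - p) - y‖ ^ 2 := by
      exact_mod_cast h1
    have h2 : c ≤ (1 - s) * a + s * b := by exact_mod_cast hmem
    have h3 : ‖p + s • (z - p) - y‖ ^ 2 =
        ‖p - y‖ ^ 2 + 2 * (s * inner ℝ (p - y) (z - p)) + s ^ 2 * ‖z - p‖ ^ 2 := by
      rw [show p + s • (z - p) - y = (p - y) + s • (z - p) by abel, norm_add_sq_real,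
        inner_smul_right, norm_smul, mul_pow, Real.norm_eq_abs, sq_abs]
    have h4 := mul_le_mul_of_nonneg_left h2 hγ.le
    rw [h3] at h1'
    nlinarith
  rw [real_inner_smul_left, ← neg_sub p y, inner_neg_left]
  have : γ * (a + γ⁻¹ * -inner ℝ (p - y) (z - p)) ≤ γ * b := by
    rw [mul_add, ← mul_assoc, mul_inv_cancel₀ hγ.ne']
    linarith
  exact le_of_mul_le_mul_left this hγ

/-- Around a point of the relative interior, a set contains all small displacements along its
affine hull. -/
lemma exists_forall_add_mem_of_mem_intrinsicInterior {S : Set (Eucl n)} {u : Eucl n}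
    (hu : u ∈ intrinsicInterior ℝ S) :
    ∃ r > 0, ∀ w ∈ vectorSpan ℝ S, ‖w‖ < r → u + w ∈ S := by
  obtain ⟨y, hy, rfl⟩ := mem_intrinsicInterior.1 hu
  obtain ⟨r, hr, hball⟩ := Metric.mem_nhds_iff.1 (mem_interior_iff_mem_nhds.1 hy)
  refine ⟨r, hr, fun w hw hwr => ?_⟩
  have hmem : (y : Eucl n) + w ∈ affineSpan ℝ S := by
    have := AffineSubspace.vadd_mem_of_mem_direction (s := affineSpan ℝ S)
      (by rwa [direction_affineSpan]) y.2
    rwa [vadd_eq_add, add_comm] at this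
  have : (⟨(y : Eucl n) + w, hmem⟩ : affineSpan ℝ S) ∈ Metric.ball y r := by
    rw [Metric.mem_ball, Subtype.dist_eq, dist_eq_norm]
    simpa using hwr
  exact hball this

/-! ### Local retractions and tangent spaces -/

/-- `Ψ` is, around `x`, a `C²` retraction onto `M` whose fibres are parallel to `Tᗮ`. -/
structure IsLocalRetraction (M : Set (Eucl n)) (x : Eucl n) (T : Submodule ℝ (Eucl n))
    (Ψ : Eucl n → Eucl n) : Prop where
  contDiffAt : ContDiffAt ℝ 2 Ψ x
  mem : x ∈ M
  eventually_mem : ∀ᶠ z in 𝓝 x, Ψ z ∈ M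
  eventually_fix : ∀ᶠ z in 𝓝 x, z ∈ M → Ψ z = z
  proj_map : ∀ᶠ z in 𝓝 x, T.starProjection (Ψ z) = T.starProjection z
  map_proj : ∀ z, Ψ (T.starProjection z) = Ψ z
  fderiv_mem : ∀ w, fderiv ℝ Ψ x w ∈ T

/-- The derivative of a chart straightening a level set. -/
lemma bijective_prod_orthogonalProjection_ker {d : ℕ} {A : Eucl n →L[ℝ] Eucl d}
    (hA : Function.Surjective A) :
    (A.prod A.ker.orthogonalProjectionOnto).ker = ⊥ ∧
    (A.prod A.ker.orthogonalProjectionOnto).range = ⊤ := by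
  constructor
  · rw [LinearMap.ker_eq_bot']
    intro w hw
    obtain ⟨h1, h2⟩ := Prod.ext_iff.1 hw
    have hw' : w ∈ A.ker := h1
    have := A.ker.starProjection_eq_self_iff.2 hw'
    rw [← this, Submodule.starProjection_apply]
    exact congrArg Subtype.val h2
  · rw [LinearMap.range_eq_top]
    rintro ⟨a, t⟩
    obtain ⟨w, rfl⟩ := hA a
    refine ⟨w - A.ker.starProjection w + t, ?_⟩
    have hP : A (A.ker.starProjection w) = 0 := A.ker.starProjection_apply_mem w
    have ht : A (t : Eucl n) = 0 := t.2
    refine Prod.ext ?_ ?_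
    · simp [hP, ht]
    · have : A.ker.orthogonalProjectionOnto (A.ker.starProjection w) = A.ker.orthogonalProjectionOnto w := by
        rw [Submodule.starProjection_apply, Submodule.orthogonalProjectionOnto_mem_subspace_eq_self]
      simp [this]

/-- The chart `Θ = (g, P_ker)` flattens `M` to `{0} × ker Dg(x)`. Erasing the first coordinate and
applying the local inverse of `Θ` moves a point orthogonally to `T = ker Dg(x)` until it meets `M`.
-/
lemma IsC2ManifoldAround.exists_isLocalRetraction {M : Set (Eucl n)} {x : Eucl n}
    (h : IsC2ManifoldAround M x) :
    ∃ (T : Submodule ℝ (Eucl n)) (Ψ : Eucl n → Eucl n), IsLocalRetraction M x T Ψ := by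
  obtain ⟨hx, d, g, hg, hsurj, hM⟩ := h
  set A := fderiv ℝ g x with hA
  have hgx : g x = 0 := hM.self_of_nhds.1 hx
  let Θ : Eucl n → Eucl d × A.ker := fun z => (g z, A.ker.orthogonalProjectionOnto z)
  let e : Eucl n ≃L[ℝ] Eucl d × A.ker :=
    ContinuousLinearEquiv.ofBijective (A.prod A.ker.orthogonalProjectionOnto)
      (bijective_prod_orthogonalProjection_ker hsurj).1
      (bijective_prod_orthogonalProjection_ker hsurj).2
  have hΘ : ContDiffAt ℝ 2 Θ x := hg.prodMk A.ker.orthogonalProjectionOnto.contDiff.contDiffAt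
  have hgd : HasFDerivAt g A x := (hg.differentiableAt (by norm_num)).hasFDerivAt
  have hΘ' : HasFDerivAt Θ (e : Eucl n →L[ℝ] Eucl d × A.ker) x :=
    hgd.prodMk A.ker.orthogonalProjectionOnto.hasFDerivAt
  have hs := hΘ.hasStrictFDerivAt' hΘ' (by norm_num)
  let ψ := hΘ.localInverse hΘ' (by norm_num)
  let ι : Eucl n → Eucl d × A.ker := fun z => (0, A.ker.orthogonalProjectionOnto z)
  have hι : ContDiff ℝ 2 ι := contDiff_const.prodMk A.ker.orthogonalProjectionOnto.contDiff
  have hιx : ι x = Θ x := by simp [ι, Θ, hgx]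
  have hψ : ContDiffAt ℝ 2 ψ (ι x) := hιx ▸ hΘ.to_localInverse hΘ' (by norm_num)
  have hψx : ψ (ι x) = x := by rw [hιx]; exact hΘ.localInverse_apply_image hΘ' (by norm_num)
  have hΨ : ContDiffAt ℝ 2 (fun z => ψ (ι z)) x := hψ.comp x hι.contDiffAt
  have hιt : Tendsto ι (𝓝 x) (𝓝 (Θ x)) := hιx ▸ hι.continuous.tendsto x
  have hr : ∀ᶠ z in 𝓝 x, Θ (ψ (ι z)) = ι z := hιt.eventually hs.eventually_right_inverse
  have hl : ∀ᶠ z in 𝓝 x, ψ (Θ z) = z := hs.eventually_left_inverse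
  have hΨt : Tendsto (fun z => ψ (ι z)) (𝓝 x) (𝓝 x) := by
    have := hΨ.continuousAt.tendsto
    rwa [hψx] at this
  have hg0 : ∀ᶠ z in 𝓝 x, g (ψ (ι z)) = 0 := hr.mono fun z hz => congrArg Prod.fst hz
  refine ⟨A.ker, fun z => ψ (ι z), hΨ, hx, ?_, ?_, ?_, ?_, ?_⟩
  · filter_upwards [hΨt.eventually hM, hg0] with z hz h0 using hz.2 h0
  · filter_upwards [hM, hl] with z hz hlz hzM
    have : ι z = Θ z := by simp [ι, Θ, hz.1 hzM]
    rw [this, hlz]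
  · filter_upwards [hr] with z hz
    rw [Submodule.starProjection_apply, Submodule.starProjection_apply]
    exact congrArg Subtype.val (congrArg Prod.snd hz)
  · intro z
    simp only [ι]
    rw [Submodule.starProjection_apply, Submodule.orthogonalProjectionOnto_mem_subspace_eq_self]
  · intro w
    have hd : HasFDerivAt (fun z => ψ (ι z)) (fderiv ℝ (fun z => ψ (ι z)) x) x :=
      (hΨ.differentiableAt (by norm_num)).hasFDerivAt
    have hgd' : HasFDerivAt g A (ψ (ι x)) := by rwa [hψx]
    have h1 := hgd'.comp x hd
    have h2 : HasFDerivAt (g ∘ fun z => ψ (ι z)) (0 : Eucl n →L[ℝ] Eucl d) x :=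
      (hasFDerivAt_const (0 : Eucl d) x).congr_of_eventuallyEq hg0
    exact congrArg (fun B : Eucl n →L[ℝ] Eucl d => B w) (h1.unique h2)

namespace IsLocalRetraction

variable {M : Set (Eucl n)} {x : Eucl n} {T : Submodule ℝ (Eucl n)} {Ψ : Eucl n → Eucl n}

lemma map_self (h : IsLocalRetraction M x T Ψ) : Ψ x = x := h.eventually_fix.self_of_nhds h.mem

lemma tendsto (h : IsLocalRetraction M x T Ψ) : Tendsto Ψ (𝓝 x) (𝓝 x) := by
  have := h.contDiffAt.continuousAt.tendsto
  rwa [h.map_self] at this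

lemma eventually_hasFDerivAt (h : IsLocalRetraction M x T Ψ) :
    ∀ᶠ y in 𝓝 x, HasFDerivAt Ψ (fderiv ℝ Ψ y) y :=
  (h.contDiffAt.eventually (by simp)).mono fun _ hy =>
    (hy.differentiableAt (by norm_num)).hasFDerivAt

/-- Differentiating `P_T ∘ Ψ = P_T` gives `P_T DΨ(x) = P_T`, and `DΨ(x)` already takes values in
`T`. -/
lemma fderiv_self (h : IsLocalRetraction M x T Ψ) : fderiv ℝ Ψ x = T.starProjection := by
  have h1 := T.starProjection.hasFDerivAt.comp x h.eventually_hasFDerivAt.self_of_nhds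
  have h2 : HasFDerivAt (T.starProjection ∘ Ψ) T.starProjection x :=
    T.starProjection.hasFDerivAt.congr_of_eventuallyEq h.proj_map
  ext1 w
  rw [← h1.unique h2, ContinuousLinearMap.comp_apply,
    T.starProjection_eq_self_iff.2 (h.fderiv_mem w)]

lemma map_add_proj (h : IsLocalRetraction M x T Ψ) (y w : Eucl n) :
    Ψ (y + T.starProjection w) = Ψ (y + w) := by
  rw [← h.map_proj, ← h.map_proj (y + w), map_add, map_add,
    T.starProjection_eq_self_iff.2 (T.starProjection_apply_mem w)]

lemma eventually_fderiv_proj (h : IsLocalRetraction M x T Ψ) :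
    ∀ᶠ y in 𝓝 x, ∀ w, fderiv ℝ Ψ y (T.starProjection w) = fderiv ℝ Ψ y w := by
  filter_upwards [h.eventually_hasFDerivAt] with y hy w
  have h1 : HasFDerivAt (fun w => Ψ (y + w)) (fderiv ℝ Ψ y) 0 := by
    have := (hasFDerivAt_comp_add_left (f := Ψ) (f' := fderiv ℝ Ψ y) (x := 0) y).2 (by simpa)
    exact this
  have h2 : HasFDerivAt (fun w => Ψ (y + T.starProjection w))
      (fderiv ℝ Ψ y ∘L T.starProjection) 0 :=
    HasFDerivAt.comp (g := fun w => Ψ (y + w)) 0 (by simpa using h1) T.starProjection.hasFDerivAt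
  simp_rw [h.map_add_proj] at h2
  exact congrArg (fun B : Eucl n →L[ℝ] Eucl n => B w) (h2.unique h1)

/-- `DΨ(y)` is a projection, possibly oblique, onto the tangent space at `y`: `Ψ` agrees with the
identity on `M`, and it maps a whole neighbourhood of `y` into `M`. -/
lemma tangentSpaceAt_eventually (h : IsLocalRetraction M x T Ψ) :
    ∀ᶠ y in 𝓝 x, y ∈ M → (∀ w ∈ tangentSpaceAt M y, fderiv ℝ Ψ y w = w) ∧
      ∀ w, fderiv ℝ Ψ y w ∈ tangentSpaceAt M y := by
  filter_upwards [h.eventually_hasFDerivAt, h.eventually_fix.eventually_nhds,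
    h.eventually_mem.eventually_nhds] with y hy hfix hmem hyM
  have hyy : Ψ y = y := hfix.self_of_nhds hyM
  constructor
  · have h1 : HasFDerivWithinAt Ψ (ContinuousLinearMap.id ℝ (Eucl n)) M y := by
      refine (hasFDerivWithinAt_id y M).congr_of_eventuallyEq ?_ hyy
      filter_upwards [self_mem_nhdsWithin, nhdsWithin_le_nhds hfix] with z hz hf using hf hz
    have heq := hy.hasFDerivWithinAt.unique_on h1
    have : tangentSpaceAt M y ≤ LinearMap.eqLocus (fderiv ℝ Ψ y : Eucl n →ₗ[ℝ] Eucl n)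
        (LinearMap.id) := Submodule.span_le.2 fun w hw => heq hw
    exact fun w hw => this hw
  · intro w
    refine Submodule.subset_span ?_
    obtain ⟨U, hU, hUo, hyU⟩ := eventually_nhds_iff.1 hmem
    have h1 := (hy.hasFDerivWithinAt (s := U)).mapsTo_tangent_cone
    have h2 : tangentConeAt ℝ U y = Set.univ := tangentConeAt_of_mem_nhds (hUo.mem_nhds hyU)
    have h3 := h1 (h2 ▸ Set.mem_univ w)
    rw [hyy] at h3
    refine tangentConeAt_mono ?_ h3
    rintro _ ⟨z, hz, rfl⟩
    exact hU z hz

lemma tangentSpaceAt_self (h : IsLocalRetraction M x T Ψ) : tangentSpaceAt M x = T := by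
  obtain ⟨h1, h2⟩ := h.tangentSpaceAt_eventually.self_of_nhds h.mem
  rw [h.fderiv_self] at h1 h2
  refine le_antisymm (fun w hw => ?_) fun w hw => ?_
  · exact T.starProjection_eq_self_iff.1 (h1 w hw)
  · rw [← T.starProjection_eq_self_iff.2 hw]
    exact h2 w

lemma eventually_sub_mem (h : IsLocalRetraction M x T Ψ) : ∀ᶠ z in 𝓝 x, z - Ψ z ∈ Tᗮ := by
  filter_upwards [h.proj_map] with z hz
  rw [← T.starProjection_apply_eq_zero_iff, map_sub, hz, sub_self]

end IsLocalRetraction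

/-! ### Finite identification -/

/-- Finite identification of the active manifold of a partly smooth convex function. -/
lemma PartlySmooth.eventually_mem {R : Eucl n → EReal} {M : Set (Eucl n)} {xs u : Eucl n}
    (hps : PartlySmooth R M xs) (hR : IsProperFun R)
    (hu : u ∈ intrinsicInterior ℝ (subdifferential R xs)) {x v : ℕ → Eucl n}
    (hx : Tendsto x atTop (𝓝 xs)) (hv : Tendsto v atTop (𝓝 u))
    (hsub : ∀ᶠ k in atTop, v k ∈ subdifferential R (x k)) : ∀ᶠ k in atTop, x k ∈ M := by
  obtain ⟨T, Ψ, hΨ⟩ := hps.manifold.exists_isLocalRetraction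
  obtain ⟨r, hr, hball⟩ := exists_forall_add_mem_of_mem_intrinsicInterior hu
  by_contra hcon
  obtain ⟨φ, hφ, hφM⟩ := extraction_of_frequently_atTop (not_eventually.1 hcon)
  -- Normalised displacement from the retracted point to an iterate off `M`. It is a unit vector
  -- once `Ψ` lands in `M`, and lies in the unit ball in any case.
  let dir : ℕ → Eucl n := fun k => ‖x (φ k) - Ψ (x (φ k))‖⁻¹ • (x (φ k) - Ψ (x (φ k)))
  have hdir : ∀ k, dir k ∈ Metric.closedBall (0 : Eucl n) 1 := by
    intro k
    rw [mem_closedBall_zero_iff, norm_smul, norm_inv, norm_norm]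
    exact inv_mul_le_one
  obtain ⟨ν, -, θ, hθ, hν⟩ := (isCompact_closedBall (0 : Eucl n) 1).tendsto_subseq hdir
  have hφθ : Tendsto (fun k => φ (θ k)) atTop atTop := hφ.tendsto_atTop.comp hθ.tendsto_atTop
  have hxx : Tendsto (fun k => x (φ (θ k))) atTop (𝓝 xs) := hx.comp hφθ
  have hpos : ∀ᶠ k in atTop, 0 < ‖x (φ (θ k)) - Ψ (x (φ (θ k)))‖ := by
    filter_upwards [hxx.eventually hΨ.eventually_mem] with k hk
    rw [norm_pos_iff, sub_ne_zero]
    intro h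
    exact hφM (θ k) (h ▸ hk)
  have hν1 : ‖ν‖ = 1 := by
    refine tendsto_nhds_unique hν.norm (tendsto_const_nhds.congr' ?_)
    filter_upwards [hpos] with k hk
    simp only [Function.comp_apply, dir]
    rw [norm_smul, norm_inv, norm_norm, inv_mul_cancel₀ hk.ne']
  have hνT : ν ∈ vectorSpan ℝ (subdifferential R xs) := by
    have h1 : ν ∈ Tᗮ := by
      refine T.isClosed_orthogonal.mem_of_tendsto hν ?_
      filter_upwards [hxx.eventually hΨ.eventually_sub_mem] with k hk
      exact Tᗮ.smul_mem _ hk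
    rwa [← hΨ.tangentSpaceAt_self, hps.sharp, Submodule.orthogonal_orthogonal] at h1
  -- Moving `u` by `r/2` stays within the radius `r`. Approximating the new subgradient to within
  -- `r/4` then leaves room: monotonicity fails because `-r/2 + r/4 < 0`.
  have hw := hball ((r / 2) • ν) (Submodule.smul_mem _ _ hνT) (by
    rw [norm_smul, hν1, mul_one, Real.norm_of_nonneg (by positivity)]; linarith)
  have hΨx : Tendsto (fun k => Ψ (x (φ (θ k)))) atTop (𝓝[M] xs) :=
    tendsto_nhdsWithin_iff.2 ⟨hΨ.tendsto.comp hxx, hxx.eventually hΨ.eventually_mem⟩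
  have hinner := hΨx.eventually (hps.continuous.1 _ hw (r / 4) (by positivity))
  have hlim : Tendsto (fun k => (inner ℝ (v (φ (θ k)) - (u + (r / 2) • ν)) (dir (θ k)) : ℝ)) atTop
      (𝓝 (inner ℝ (u - (u + (r / 2) • ν)) ν)) :=
    ((hv.comp hφθ).sub_const _).inner hν
  have hval : (inner ℝ (u - (u + (r / 2) • ν)) ν : ℝ) = -(r / 2) := by
    rw [sub_add_cancel_left, inner_neg_left, real_inner_smul_left, real_inner_self_eq_norm_sq, hν1]
    ring
  rw [hval] at hlim
  have hlt := hlim.eventually_lt_const (show -(r / 2) < -(r / 4) by linarith)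
  obtain ⟨k, hk1, hk2, ⟨w, hwS, hwd⟩, hk3⟩ :=
    (hlt.and (hpos.and (hinner.and (hφθ.eventually hsub)))).exists
  have hmono := subdifferential_monotone hR hk3 hwS
  have h1 : 0 ≤ (inner ℝ (v (φ (θ k)) - w) (dir (θ k)) : ℝ) := by
    simp only [dir]
    rw [real_inner_smul_right]
    positivity
  have h2 : (inner ℝ ((u + (r / 2) • ν) - w) (dir (θ k)) : ℝ) ≤ r / 4 := by
    refine (real_inner_le_norm _ _).trans ?_
    have h3 := mem_closedBall_zero_iff.1 (hdir (θ k))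
    rw [dist_comm, dist_eq_norm] at hwd
    calc _ ≤ r / 4 * 1 := mul_le_mul hwd.le h3 (norm_nonneg _) (by positivity)
      _ = r / 4 := mul_one _
  rw [← sub_add_sub_cancel _ (u + (r / 2) • ν) w, inner_add_left] at h1
  linarith

/-- The subgradients produced by the Forward--Backward iteration. -/
lemma forwardBackward_mem_subdifferential {R : Eucl n → EReal} (hR : IsProperFun R)
    (hRc : IsConvexFun R) {γ : ℝ} (hγ : 0 < γ) {x x' g e : Eucl n}
    (h : IsProx γ R (x - γ • (g + e)) x') :
    γ⁻¹ • (x - x') - g - e ∈ subdifferential R x' := by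
  have := h.mem_subdifferential hR hRc hγ
  convert this using 1
  rw [show x - γ • (g + e) - x' = (x - x') - γ • (g + e) by abel, smul_sub γ⁻¹ (x - x'), smul_smul,
    inv_mul_cancel₀ hγ.ne', one_smul]
  abel

lemma forwardBackward_eventually_mem {R : Eucl n → EReal} {M : Set (Eucl n)} {xs : Eucl n}
    {gradF : Eucl n → Eucl n} (hps : PartlySmooth R M xs) (hR : IsProperFun R)
    (hRc : IsConvexFun R) (hF : Continuous gradF)
    (hu : -gradF xs ∈ intrinsicInterior ℝ (subdifferential R xs))
    {γs : ℕ → ℝ} (hγs : ∀ k, 0 < γs k)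
    (hγ : ∃ γlow : ℝ, 0 < γlow ∧ ∀ᶠ k in atTop, γlow ≤ γs k) {x e : ℕ → Eucl n}
    (hprox : ∀ k, IsProx (γs k) R (x k - γs k • (gradF (x k) + e k)) (x (k + 1)))
    (he : Tendsto e atTop (𝓝 0)) (hx : Tendsto x atTop (𝓝 xs)) : ∀ᶠ k in atTop, x k ∈ M := by
  have hx1 : Tendsto (fun k => x (k + 1)) atTop (𝓝 xs) := hx.comp (tendsto_add_atTop_nat 1)
  have hstep : Tendsto (fun k => (γs k)⁻¹ • (x k - x (k + 1))) atTop (𝓝 0) := by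
    obtain ⟨γlow, hpos, hlow⟩ := hγ
    have hdiff : Tendsto (fun k => x k - x (k + 1)) atTop (𝓝 0) := by
      simpa using hx.sub hx1
    refine squeeze_zero_norm' (a := fun k => γlow⁻¹ * ‖x k - x (k + 1)‖) ?_
      (by simpa using hdiff.norm.const_mul γlow⁻¹)
    filter_upwards [hlow] with k hk
    rw [norm_smul, norm_inv, Real.norm_of_nonneg (hγs k).le]
    gcongr
  have hv : Tendsto (fun k => (γs k)⁻¹ • (x k - x (k + 1)) - gradF (x k) - e k) atTop
      (𝓝 (-gradF xs)) := by
    simpa using (hstep.sub ((hF.tendsto xs).comp hx)).sub he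
  have hmem := hps.eventually_mem hR hu hx1 hv (Eventually.of_forall fun k =>
    forwardBackward_mem_subdifferential hR hRc (hγs k) (hprox k))
  obtain ⟨K, hK⟩ := eventually_atTop.1 hmem
  -- The subgradient of step `k` sits at `x_{k+1}`, hence the shift by one.
  refine eventually_atTop.2 ⟨K + 1, fun k hk => ?_⟩
  obtain ⟨j, rfl⟩ : ∃ j, k = j + 1 := ⟨k - 1, by omega⟩
  exact hK j (by omega)

lemma exists_pos_eventually_le_of_le_liminf {γs : ℕ → ℝ}
    (h : ∃ γlow : ℝ, 0 < γlow ∧ (γlow : EReal) ≤ liminf (fun k => ((γs k : ℝ) : EReal)) atTop) :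
    ∃ γlow : ℝ, 0 < γlow ∧ ∀ᶠ k in atTop, γlow ≤ γs k := by
  obtain ⟨c, hc, hlim⟩ := h
  refine ⟨c / 2, by positivity, ?_⟩
  have hlt : ((c / 2 : ℝ) : EReal) < liminf (fun k => ((γs k : ℝ) : EReal)) atTop :=
    lt_of_lt_of_le (by exact_mod_cast half_lt_self hc) hlim
  filter_upwards [eventually_lt_of_lt_liminf hlt] with k hk
  exact (EReal.coe_lt_coe_iff.1 hk).le

/-! ### The averaged gradient -/

lemma gradient_average {m : ℕ} {f : Fin m → Eucl n → ℝ} (hf : ∀ i, ContDiff ℝ 1 (f i))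
    (x : Eucl n) : gradient (average f) x = (1 / (m : ℝ)) • ∑ i, gradient (f i) x := by
  have hd : ∀ i, HasFDerivAt (f i) (fderiv ℝ (f i) x) x := fun i =>
    ((hf i).differentiable (by norm_num) x).hasFDerivAt
  have h : HasFDerivAt (average f) ((1 / (m : ℝ)) • ∑ i, fderiv ℝ (f i) x) x :=
    (HasFDerivAt.fun_sum fun i _ => hd i).const_mul _
  rw [gradient, h.fderiv, map_smulₛₗ, map_sum]
  rfl

lemma lipschitzWith_gradient_average {m : ℕ} (hm : 0 < m) {f : Fin m → Eucl n → ℝ}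
    {Li : Fin m → ℝ≥0} (hf : ∀ i, ContDiff ℝ 1 (f i))
    (hlip : ∀ i, LipschitzWith (Li i) (gradient (f i))) :
    LipschitzWith (Finset.univ.sup Li) (gradient (average f)) := by
  have hm' : (0 : ℝ) < m := by exact_mod_cast hm
  refine LipschitzWith.of_dist_le_mul fun x y => ?_
  rw [gradient_average hf, gradient_average hf, dist_eq_norm, ← smul_sub, ← Finset.sum_sub_distrib,
    norm_smul, Real.norm_of_nonneg (by positivity)]
  have hsum : ‖∑ i, (gradient (f i) x - gradient (f i) y)‖ ≤
      ∑ _i : Fin m, ((Finset.univ.sup Li : ℝ≥0) : ℝ) * dist x y := by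
    refine norm_sum_le_of_le _ fun i _ => ?_
    rw [← dist_eq_norm]
    refine ((hlip i).dist_le_mul x y).trans ?_
    have : (Li i : ℝ) ≤ (Finset.univ.sup Li : ℝ≥0) := by
      exact_mod_cast Finset.le_sup (f := Li) (Finset.mem_univ i)
    gcongr
  rw [Finset.sum_const, Finset.card_univ, Fintype.card_fin, nsmul_eq_mul] at hsum
  calc _ ≤ 1 / (m : ℝ) * (m * (((Finset.univ.sup Li : ℝ≥0) : ℝ) * dist x y)) := by gcongr
    _ = _ := by field_simp

/-! ### Second-order calculus and Landau symbols -/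

lemma hasFDerivAt_gradient {q : Eucl n → ℝ} {x : Eucl n} (hq : ContDiffAt ℝ 2 q x) :
    HasFDerivAt (gradient q) (fderiv ℝ (gradient q) x) x := by
  let J : (Eucl n →L[ℝ] ℝ) →ₗ[ℝ] Eucl n :=
    { toFun := fun φ => (InnerProductSpace.toDual ℝ (Eucl n)).symm φ
      map_add' := fun a b => map_add _ a b
      map_smul' := fun a b => by simp }
  have h1 : DifferentiableAt ℝ (fderiv ℝ q) x :=
    (hq.fderiv_right (m := 1) (by norm_num)).differentiableAt (by norm_num)
  exact ((LinearMap.toContinuousLinearMap J).differentiableAt.comp x h1).hasFDerivAt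

lemma inner_gradient (q : Eucl n → ℝ) (x w : Eucl n) :
    inner ℝ (gradient q x) w = fderiv ℝ q x w :=
  InnerProductSpace.toDual_symm_apply

lemma ContDiffAt.eventually_hasFDerivAt {q : Eucl n → ℝ} {x : Eucl n} (hq : ContDiffAt ℝ 2 q x) :
    ∀ᶠ y in 𝓝 x, HasFDerivAt q (fderiv ℝ q y) y :=
  (hq.eventually (by simp)).mono fun _ hy => (hy.differentiableAt (by norm_num)).hasFDerivAt

/-- Were the second derivative along `w` negative, the first one, zero at the start, would be
negative just after it, and `q` would strictly decrease from its minimum. -/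
lemma fderiv_gradient_nonneg_of_isLocalMin {q : Eucl n → ℝ} {x : Eucl n} (hq : ContDiffAt ℝ 2 q x)
    (hmin : IsLocalMin q x) (w : Eucl n) : 0 ≤ inner ℝ (fderiv ℝ (gradient q) x w) w := by
  have hline : HasDerivAt (fun s : ℝ => x + s • w) w 0 := by
    simpa using ((hasDerivAt_id (0 : ℝ)).smul_const w).const_add x
  have hlim : Tendsto (fun s : ℝ => x + s • w) (𝓝 0) (𝓝 x) := by
    have := hline.continuousAt.tendsto
    simpa using this
  have hder : ∀ᶠ s in 𝓝 (0 : ℝ), HasDerivAt (fun s : ℝ => q (x + s • w))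
      (inner ℝ (gradient q (x + s • w)) w) s := by
    filter_upwards [hlim.eventually (ContDiffAt.eventually_hasFDerivAt hq)] with s hs
    rw [inner_gradient]
    have hl : HasDerivAt (fun s : ℝ => x + s • w) w s := by
      simpa using ((hasDerivAt_id s).smul_const w).const_add x
    exact hs.comp_hasDerivAt s hl
  have h2 : HasDerivAt (fun s : ℝ => (inner ℝ (gradient q (x + s • w)) w : ℝ))
      (inner ℝ (fderiv ℝ (gradient q) x w) w) 0 := by
    have h3 : HasDerivAt (fun s : ℝ => gradient q (x + s • w)) (fderiv ℝ (gradient q) x w) 0 := by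
      have h4 : HasFDerivAt (gradient q) (fderiv ℝ (gradient q) x) (x + (0 : ℝ) • w) := by
        simpa using hasFDerivAt_gradient hq
      exact h4.comp_hasDerivAt 0 hline
    simpa using h3.inner ℝ (hasDerivAt_const (0 : ℝ) w)
  by_contra! hneg
  have hzero : (inner ℝ (gradient q x) w : ℝ) = 0 := by
    rw [inner_gradient, hmin.fderiv_eq_zero]; rfl
  have hdneg : ∀ᶠ s in 𝓝[>] (0 : ℝ), (inner ℝ (gradient q (x + s • w)) w : ℝ) < 0 := by
    have := (hasDerivAt_iff_tendsto_slope.1 h2).eventually_lt_const hneg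
    filter_upwards [nhdsGT_le_nhdsNE (0 : ℝ) this, self_mem_nhdsWithin] with s hs hs0
    rw [Set.mem_Ioi] at hs0
    simp only [slope, sub_zero, zero_smul, add_zero, hzero, vsub_eq_sub, smul_eq_mul] at hs
    by_contra! hc
    exact absurd hs (not_lt.2 (mul_nonneg (inv_nonneg.2 hs0.le) hc))
  have hmin' : ∀ᶠ s in 𝓝[>] (0 : ℝ), q x ≤ q (x + s • w) :=
    nhdsWithin_le_nhds (hlim.eventually hmin)
  obtain ⟨b, hb0, hb⟩ := mem_nhdsGT_iff_exists_Ioo_subset.1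
    ((hdneg.and (nhdsWithin_le_nhds hder)).and hmin')
  rw [Set.mem_Ioi] at hb0
  have hd0 : HasDerivAt (fun s : ℝ => q (x + s • w)) (inner ℝ (gradient q (x + (0 : ℝ) • w)) w) 0 :=
    hder.self_of_nhds
  have hanti : StrictAntiOn (fun s : ℝ => q (x + s • w)) (Set.Icc 0 (b / 2)) := by
    refine strictAntiOn_of_deriv_neg (convex_Icc _ _) (fun s hs => ?_) fun s hs => ?_
    · rcases hs.1.eq_or_lt with rfl | hs0
      · exact hd0.continuousAt.continuousWithinAt
      · exact (hb ⟨hs0, by linarith [hs.2]⟩).1.2.continuousAt.continuousWithinAt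
    · rw [interior_Icc] at hs
      have := hb ⟨hs.1, by linarith [hs.2]⟩
      rw [this.1.2.deriv]
      exact this.1.1
  have h5 := hanti (Set.left_mem_Icc.2 (by positivity)) (Set.right_mem_Icc.2 (by positivity))
    (by positivity)
  have h6 : q x ≤ q (x + (b / 2) • w) := (hb ⟨by positivity, by linarith⟩).2
  simp only [zero_smul, add_zero] at h5
  linarith

/-- Vanishing operators turn `O` into `o`. -/
lemma isLittleO_clm_apply {α V : Type*} [SeminormedAddCommGroup V] {l : Filter α}
    {A : α → Eucl n →L[ℝ] Eucl n} {z : α → Eucl n} {N : α → V} (hA : Tendsto A l (𝓝 0))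
    (hz : z =O[l] N) : (fun i => A i (z i)) =o[l] N := by
  have h : (fun i => ‖A i‖ * ‖z i‖) =o[l] fun i => (1 : ℝ) * ‖N i‖ :=
    ((isLittleO_one_iff ℝ).2 hA).norm_left.mul_isBigO hz.norm_norm
  simp only [one_mul] at h
  refine IsBigO.trans_isLittleO (IsBigO.of_bound 1 (Eventually.of_forall fun i => ?_))
    h.of_norm_right
  rw [one_mul, Real.norm_of_nonneg (by positivity)]
  exact (A i).le_opNorm _

/-- A family of operators which is continuous at `x`, applied to a function vanishing at `x`. -/
lemma HasFDerivAt.clm_apply_of_eq_zero {A : Eucl n → Eucl n →L[ℝ] Eucl n} {u : Eucl n → Eucl n}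
    {u' : Eucl n →L[ℝ] Eucl n} {x : Eucl n} (hA : ContinuousAt A x) (hu : HasFDerivAt u u' x)
    (h0 : u x = 0) : HasFDerivAt (fun y => A y (u y)) (A x ∘L u') x := by
  have h1 : (fun y => (A y - A x) (u y)) =o[𝓝 x] fun y => y - x := by
    have hO : u =O[𝓝 x] fun y => y - x := by simpa [h0] using hu.isBigO_sub
    exact isLittleO_clm_apply (by simpa using hA.tendsto.sub_const (A x)) hO
  have h2 := (A x).hasFDerivAt.comp x hu
  refine HasFDerivAt.of_isLittleO ?_
  refine (h1.add h2.isLittleO).congr_left fun y => ?_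
  simp [h0]

/-! ### The pullback of `R` along the retraction -/

/-- The pullback of `G + ⟪c, ·⟫` under `Ψ`. -/
noncomputable def tiltedPullback (G : Eucl n → ℝ) (Ψ : Eucl n → Eucl n) (c : Eucl n) (z : Eucl n) : ℝ :=
  G (Ψ z) + inner ℝ c (Ψ z)

/-- The adjoint of the derivative of `Ψ`. -/
noncomputable def adjDeriv (Ψ : Eucl n → Eucl n) (y : Eucl n) : Eucl n →L[ℝ] Eucl n :=
  ContinuousLinearMap.adjoint (fderiv ℝ Ψ y)

lemma inner_adjDeriv (Ψ : Eucl n → Eucl n) (y v w : Eucl n) :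
    (inner ℝ (adjDeriv Ψ y v) w : ℝ) = inner ℝ v (fderiv ℝ Ψ y w) :=
  ContinuousLinearMap.adjoint_inner_left _ _ _

lemma starProjection_adjoint (T : Submodule ℝ (Eucl n)) :
    ContinuousLinearMap.adjoint T.starProjection = T.starProjection :=
  (ContinuousLinearMap.isSelfAdjoint_iff_isSymmetric.2 T.starProjection_isSymmetric).adjoint_eq

namespace IsLocalRetraction

variable {M : Set (Eucl n)} {x : Eucl n} {T : Submodule ℝ (Eucl n)} {Ψ : Eucl n → Eucl n}

lemma continuousAt_fderiv (h : IsLocalRetraction M x T Ψ) : ContinuousAt (fderiv ℝ Ψ) x :=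
  (h.contDiffAt.fderiv_right (m := 1) (by norm_num)).continuousAt

lemma continuousAt_adjDeriv (h : IsLocalRetraction M x T Ψ) : ContinuousAt (adjDeriv Ψ) x :=
  (ContinuousLinearMap.adjoint (𝕜 := ℝ) (E := Eucl n) (F := Eucl n)).continuous.continuousAt.comp
    h.continuousAt_fderiv

lemma adjDeriv_self (h : IsLocalRetraction M x T Ψ) : adjDeriv Ψ x = T.starProjection := by
  rw [adjDeriv, h.fderiv_self, starProjection_adjoint]

variable {G : Eucl n → ℝ} {c : Eucl n}

lemma contDiffAt_tiltedPullback (h : IsLocalRetraction M x T Ψ) (hG : ContDiffAt ℝ 2 G x) :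
    ContDiffAt ℝ 2 (tiltedPullback G Ψ c) x := by
  have hG' : ContDiffAt ℝ 2 G (Ψ x) := by rwa [h.map_self]
  exact (hG'.comp x h.contDiffAt).add (contDiffAt_const.inner ℝ h.contDiffAt)

lemma eventually_gradient_tiltedPullback (h : IsLocalRetraction M x T Ψ)
    (hG : ContDiffAt ℝ 2 G x) : ∀ᶠ y in 𝓝 x,
      gradient (tiltedPullback G Ψ c) y = adjDeriv Ψ y (gradient G (Ψ y) + c) := by
  filter_upwards [h.eventually_hasFDerivAt,
    h.tendsto.eventually (ContDiffAt.eventually_hasFDerivAt hG)] with y hy hGy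
  have h1 : HasFDerivAt (tiltedPullback G Ψ c)
      (fderiv ℝ G (Ψ y) ∘L fderiv ℝ Ψ y + (innerSL ℝ c) ∘L fderiv ℝ Ψ y) y :=
    (hGy.comp y hy).add ((innerSL ℝ c).hasFDerivAt.comp y hy)
  refine ext_inner_right ℝ fun w => ?_
  rw [inner_gradient, h1.fderiv, inner_adjDeriv, inner_add_left, inner_gradient]
  rfl

/-- The pullback is constant in the directions of `Tᗮ`, since `Ψ z` depends only on `P_T z`. -/
lemma eventually_proj_gradient_tiltedPullback (h : IsLocalRetraction M x T Ψ)
    (hG : ContDiffAt ℝ 2 G x) : ∀ᶠ y in 𝓝 x,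
      T.starProjection (gradient (tiltedPullback G Ψ c) y) = gradient (tiltedPullback G Ψ c) y := by
  filter_upwards [h.eventually_gradient_tiltedPullback hG (c := c), h.eventually_fderiv_proj]
    with y hy hP
  refine ext_inner_right ℝ fun w => ?_
  have : (inner ℝ (T.starProjection (gradient (tiltedPullback G Ψ c) y)) w : ℝ) =
      inner ℝ (gradient (tiltedPullback G Ψ c) y) (T.starProjection w) :=
    T.starProjection_isSymmetric _ _
  rw [this, hy, inner_adjDeriv, inner_adjDeriv, hP]

lemma proj_fderiv_gradient_tiltedPullback (h : IsLocalRetraction M x T Ψ)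
    (hG : ContDiffAt ℝ 2 G x) (w : Eucl n) :
    T.starProjection (fderiv ℝ (gradient (tiltedPullback G Ψ c)) x w) =
      fderiv ℝ (gradient (tiltedPullback G Ψ c)) x w := by
  have h1 := hasFDerivAt_gradient (h.contDiffAt_tiltedPullback hG (c := c))
  have h2 := (T.starProjection.hasFDerivAt.comp x h1).congr_of_eventuallyEq
    ((h.eventually_proj_gradient_tiltedPullback hG (c := c)).mono fun _ hy => hy.symm)
  exact congrArg (fun B : Eucl n →L[ℝ] Eucl n => B w) (h2.unique h1)

/-- Along `M`, the gradient of the pullback is determined by any subgradient. -/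
lemma gradient_tiltedPullback_eq_of_mem_subdifferential (h : IsLocalRetraction M x T Ψ)
    (hG : ContDiffAt ℝ 2 G x) {R : Eucl n → EReal} (hRG : ∀ᶠ y in 𝓝[M] x, R y = (G y : EReal)) :
    ∀ᶠ y in 𝓝 x, y ∈ M → ∀ v ∈ subdifferential R y,
      gradient (tiltedPullback G Ψ c) y = adjDeriv Ψ y (v + c) := by
  have hRΨ : ∀ᶠ z in 𝓝 x, R (Ψ z) = (G (Ψ z) : EReal) :=
    (tendsto_nhdsWithin_iff.2 ⟨h.tendsto, h.eventually_mem⟩).eventually hRG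
  filter_upwards [h.eventually_hasFDerivAt, h.eventually_gradient_tiltedPullback hG (c := c),
    h.tendsto.eventually (ContDiffAt.eventually_hasFDerivAt hG), hRΨ.eventually_nhds,
    h.eventually_fix] with y hy hgrad hGy hR hfix hyM v hv
  rw [hgrad, map_add, map_add, add_left_inj]
  have hyy := hfix hyM
  have h1 : HasFDerivAt (fun z => G (Ψ z) - inner ℝ v (Ψ z))
      (fderiv ℝ G (Ψ y) ∘L fderiv ℝ Ψ y - (innerSL ℝ v) ∘L fderiv ℝ Ψ y) y :=
    (hGy.comp y hy).sub ((innerSL ℝ v).hasFDerivAt.comp y hy)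
  -- Testing the subgradient inequality at `Ψ z ∈ M`, where `R = G`, shows that `y = Ψ y` is a
  -- minimum; Fermat's rule then gives `DΨ(y)*(∇G(Ψ y) - v) = 0`.
  have hmin : IsLocalMin (fun z => G (Ψ z) - inner ℝ v (Ψ z)) y := by
    filter_upwards [hR] with z hz
    have h2 := hv (Ψ z)
    have h3 := hR.self_of_nhds
    rw [hyy] at h3
    rw [hz, h3] at h2
    have h4 : G y + inner ℝ v (Ψ z - y) ≤ G (Ψ z) := by exact_mod_cast h2
    rw [inner_sub_right] at h4
    rw [hyy]
    linarith
  refine ext_inner_right ℝ fun w => ?_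
  rw [inner_adjDeriv, inner_adjDeriv, inner_gradient]
  have := congrArg (fun B : Eucl n →L[ℝ] ℝ => B w) (hmin.hasFDerivAt_eq_zero h1)
  exact sub_eq_zero.1 this

lemma isLocalMin_tiltedPullback (h : IsLocalRetraction M x T Ψ)
    {R : Eucl n → EReal} (hRG : ∀ᶠ y in 𝓝[M] x, R y = (G y : EReal))
    (hc : -c ∈ subdifferential R x) : IsLocalMin (tiltedPullback G Ψ c) x := by
  have hRΨ : ∀ᶠ z in 𝓝 x, R (Ψ z) = (G (Ψ z) : EReal) :=
    (tendsto_nhdsWithin_iff.2 ⟨h.tendsto, h.eventually_mem⟩).eventually hRG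
  have h3 := hRΨ.self_of_nhds
  rw [h.map_self] at h3
  filter_upwards [hRΨ] with z hz
  have h2 := hc (Ψ z)
  rw [hz, h3] at h2
  have h4 : G x + inner ℝ (-c) (Ψ z - x) ≤ G (Ψ z) := by exact_mod_cast h2
  rw [inner_neg_left, inner_sub_right] at h4
  simp only [tiltedPullback, h.map_self]
  linarith

end IsLocalRetraction

/-! ### Riemannian gradient and Hessian -/

lemma inner_gradientWithin_eq {φ : Eucl n → ℝ} {φ' : Eucl n →L[ℝ] ℝ} {M : Set (Eucl n)}
    {y w : Eucl n} (hφ : HasFDerivWithinAt φ φ' M y) (hw : w ∈ tangentSpaceAt M y) :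
    inner ℝ (gradientWithin φ M y) w = φ' w := by
  rw [gradientWithin, InnerProductSpace.toDual_symm_apply]
  have h1 := hφ.differentiableWithinAt.hasFDerivWithinAt.unique_on hφ
  have : tangentSpaceAt M y ≤ LinearMap.eqLocus (fderivWithin ℝ φ M y : Eucl n →ₗ[ℝ] ℝ)
      (φ' : Eucl n →ₗ[ℝ] ℝ) := Submodule.span_le.2 fun w hw => h1 hw
  exact this hw

lemma fderivWithin_apply_eq {φ : Eucl n → Eucl n} {φ' : Eucl n →L[ℝ] Eucl n} {M : Set (Eucl n)}
    {y w : Eucl n} (hφ : HasFDerivWithinAt φ φ' M y) (hw : w ∈ tangentSpaceAt M y) :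
    fderivWithin ℝ φ M y w = φ' w := by
  have h1 := hφ.differentiableWithinAt.hasFDerivWithinAt.unique_on hφ
  have : tangentSpaceAt M y ≤ LinearMap.eqLocus (fderivWithin ℝ φ M y : Eucl n →ₗ[ℝ] Eucl n)
      (φ' : Eucl n →ₗ[ℝ] Eucl n) := Submodule.span_le.2 fun w hw => h1 hw
  exact this hw

/-- The Riemannian gradient differs from its pullback by an operator vanishing at the base point. -/
lemma riemannianGradient_sub_eq {M : Set (Eucl n)} {x : Eucl n} {T : Submodule ℝ (Eucl n)}
    {Ψ : Eucl n → Eucl n} (h : IsLocalRetraction M x T Ψ) {φ g : Eucl n → ℝ}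
    (hg : ∀ᶠ y in 𝓝 x, HasFDerivAt g (fderiv ℝ g y) y) (hφ : ∀ᶠ y in 𝓝[M] x, φ y = g y) :
    ∀ᶠ y in 𝓝[M] x, riemannianGradient φ M y - adjDeriv Ψ y (gradient g y) =
      (fderiv ℝ Ψ y - adjDeriv Ψ y) (riemannianGradient φ M y) := by
  filter_upwards [nhdsWithin_le_nhds h.tangentSpaceAt_eventually, nhdsWithin_le_nhds hg,
    eventually_eventually_nhdsWithin.2 hφ, hφ, self_mem_nhdsWithin] with y ht hgy hφy hφyy hyM
  obtain ⟨ht1, ht2⟩ := ht hyM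
  have hd : HasFDerivWithinAt φ (fderiv ℝ g y) M y :=
    hgy.hasFDerivWithinAt.congr_of_eventuallyEq hφy hφyy
  have h1 : fderiv ℝ Ψ y (riemannianGradient φ M y) = riemannianGradient φ M y :=
    ht1 _ ((tangentSpaceAt M y).starProjection_apply_mem _)
  -- `DΨ(y)w` is tangent, and on tangent vectors the Riemannian gradient and `∇g` pair equally.
  have h2 : adjDeriv Ψ y (riemannianGradient φ M y) = adjDeriv Ψ y (gradient g y) := by
    refine ext_inner_right ℝ fun w => ?_
    rw [inner_adjDeriv, inner_adjDeriv, inner_gradient, ← inner_gradientWithin_eq hd (ht2 w)]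
    have := (tangentSpaceAt M y).starProjection_isSymmetric (gradientWithin φ M y)
      (fderiv ℝ Ψ y w)
    refine Eq.trans this ?_
    congr 1
    exact (tangentSpaceAt M y).starProjection_eq_self_iff.2 (ht2 w)
  rw [_root_.sub_apply, h1, h2]

/-- With `r` the Riemannian gradient, `r - p = (DΨ - DΨ*) r`. The operator tends to `P_T - P_T* =
0`, so `r - p = o(r)`; hence `r ~ p`, the difference is `o(y - x)`, and `r` inherits the derivative
of `p`. No differentiability of the tangent projection is needed. -/
lemma hasFDerivWithinAt_riemannianGradient {M : Set (Eucl n)} {x : Eucl n}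
    {T : Submodule ℝ (Eucl n)}
    {Ψ : Eucl n → Eucl n} (h : IsLocalRetraction M x T Ψ) {φ g : Eucl n → ℝ}
    (hg : ∀ᶠ y in 𝓝 x, HasFDerivAt g (fderiv ℝ g y) y) (hφ : ∀ᶠ y in 𝓝[M] x, φ y = g y)
    {p : Eucl n → Eucl n} {p' : Eucl n →L[ℝ] Eucl n} (hp : HasFDerivAt p p' x) (hp0 : p x = 0)
    (hpg : ∀ᶠ y in 𝓝[M] x, p y = adjDeriv Ψ y (gradient g y)) :
    HasFDerivWithinAt (riemannianGradient φ M) p' M x := by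
  set r := riemannianGradient φ M
  have hsub : ∀ᶠ y in 𝓝[M] x, r y - p y = (fderiv ℝ Ψ y - adjDeriv Ψ y) (r y) := by
    filter_upwards [riemannianGradient_sub_eq h hg hφ, hpg] with y h1 h2
    rw [h2, h1]
  have hlim : Tendsto (fun y => fderiv ℝ Ψ y - adjDeriv Ψ y) (𝓝[M] x) (𝓝 0) := by
    have := h.continuousAt_fderiv.tendsto.sub h.continuousAt_adjDeriv.tendsto
    rw [h.fderiv_self, h.adjDeriv_self, sub_self] at this
    exact this.mono_left nhdsWithin_le_nhds
  have hrx : r x = 0 := by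
    have := hsub.self_of_nhdsWithin h.mem
    rw [hp0, h.fderiv_self, h.adjDeriv_self] at this
    simpa using this
  have ho : (r - p) =o[𝓝[M] x] r := by
    refine (isLittleO_clm_apply hlim (isBigO_refl r _)).congr' ?_ EventuallyEq.rfl
    filter_upwards [hsub] with y hy
    rw [Pi.sub_apply, hy]
  have heq : IsEquivalent (𝓝[M] x) r p := by
    refine IsEquivalent.symm ?_
    exact ho.symm
  have hpO : p =O[𝓝[M] x] fun y => y - x := by
    simpa [hp0] using hp.hasFDerivWithinAt.isBigO_sub
  have h2 := (heq.isLittleO.trans_isBigO hpO).add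
    hp.hasFDerivWithinAt.isLittleO
  refine HasFDerivWithinAt.of_isLittleO (h2.congr_left fun y => ?_)
  simp [hrx, hp0]

/-- The operator `H_R` is the tangential Hessian of the tilted pullback of `R`. -/
lemma HR_eq {M : Set (Eucl n)} {x : Eucl n} {Ψ : Eucl n → Eucl n}
    (h : IsLocalRetraction M x (tangentSpaceAt M x) Ψ) {R : Eucl n → EReal} {G F : Eucl n → ℝ}
    (hG : ContDiffAt ℝ 2 G x) (hRG : ∀ᶠ y in 𝓝[M] x, R y = (G y : EReal))
    (hF : ContDiffAt ℝ 2 F x) (hc : -gradient F x ∈ subdifferential R x) :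
    HR R F M x =
      fderiv ℝ (gradient (tiltedPullback G Ψ (gradient F x))) x ∘L tangentProj M x := by
  set c := gradient F x
  set q := tiltedPullback G Ψ c
  have hq : ContDiffAt ℝ 2 q x := h.contDiffAt_tiltedPullback hG
  have hu : HasFDerivAt (fun y => gradient F y - c) (fderiv ℝ (gradient F) x) x :=
    (hasFDerivAt_gradient hF).sub_const c
  -- On `M`, `DΨ*∇(G + F) = ∇q + DΨ*(∇F - c)`. As `∇F - c` vanishes at `x`, continuity of `DΨ*`
  -- suffices to differentiate the product, giving `∇²q + P_T ∇²F`.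
  have hp := (hasFDerivAt_gradient hq).add
    (HasFDerivAt.clm_apply_of_eq_zero h.continuousAt_adjDeriv hu (sub_self _))
  have hFd := ContDiffAt.eventually_hasFDerivAt hF
  have hGd := ContDiffAt.eventually_hasFDerivAt hG
  have hadd : ∀ᶠ y in 𝓝 x, HasFDerivAt (fun y => G y + F y) (fderiv ℝ G y + fderiv ℝ F y) y := by
    filter_upwards [hFd, hGd] with y h1 h2 using h2.add h1
  have hq0 : gradient q x = 0 := by
    refine ext_inner_right ℝ fun w => ?_
    rw [inner_gradient, (h.isLocalMin_tiltedPullback hRG hc).fderiv_eq_zero, inner_zero_left]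
    rfl
  have hrg := hasFDerivWithinAt_riemannianGradient h (φ := fun y => (objective R F y).toReal)
    (g := fun y => G y + F y) (hadd.mono fun y hy => by rwa [hy.fderiv])
    (by
      filter_upwards [hRG] with y hy
      rw [objective, hy, ← EReal.coe_add, EReal.toReal_coe])
    hp (by simp [hq0, c])
    (by
      filter_upwards [nhdsWithin_le_nhds (h.eventually_gradient_tiltedPullback hG (c := c)),
        nhdsWithin_le_nhds h.eventually_fix, self_mem_nhdsWithin, nhdsWithin_le_nhds hadd]
        with y h1 h2 h3 h4
      have h5 : gradient (fun y => G y + F y) y = gradient G y + gradient F y := by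
        rw [gradient, h4.fderiv, map_add]; rfl
      rw [Pi.add_apply, h5, h1, h2 h3, ← map_add]
      congr 1
      abel)
  ext1 w
  have hw : tangentProj M x w ∈ tangentSpaceAt M x :=
    (tangentSpaceAt M x).starProjection_apply_mem w
  have hidem : ∀ v, tangentProj M x (tangentProj M x v) = tangentProj M x v := fun v =>
    (tangentSpaceAt M x).starProjection_eq_self_iff.2
      ((tangentSpaceAt M x).starProjection_apply_mem v)
  have hPH := h.proj_fderiv_gradient_tiltedPullback hG (c := c)
  simp only [HR, HF, riemannianHessian, _root_.sub_apply,
    ContinuousLinearMap.comp_apply]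
  rw [fderivWithin_apply_eq hrg hw, _root_.add_apply, map_add,
    ContinuousLinearMap.comp_apply, h.adjDeriv_self]
  have h6 := hidem (fderiv ℝ (gradient F) x (tangentProj M x w))
  have h7 := hPH (tangentProj M x w)
  simp only [tangentProj] at h6 h7 ⊢
  rw [h6, h7, add_sub_cancel_right]

/-! ### Invertibility of `Id + γ H_R` and `Id - γ H_F` -/

lemma isInvertible_of_forall_eq_zero {A : Eucl n →L[ℝ] Eucl n} (h : ∀ w, A w = 0 → w = 0) :
    A.IsInvertible := by
  have hinj : Function.Injective (A : Eucl n →ₗ[ℝ] Eucl n) :=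
    (injective_iff_map_eq_zero (A : Eucl n →ₗ[ℝ] Eucl n)).2 h
  exact ⟨(LinearEquiv.ofInjectiveEndo (A : Eucl n →ₗ[ℝ] Eucl n) hinj).toContinuousLinearEquiv,
    by ext1 w; rfl⟩

/-- A kernel vector satisfies `w = -γ H P_T w ∈ T`, so `P_T w = w` and `‖w‖² = -γ⟪Hw, w⟫ ≤ 0`. -/
lemma isInvertible_id_add_smul_comp_proj {T : Submodule ℝ (Eucl n)} {H : Eucl n →L[ℝ] Eucl n}
    (hH : ∀ w, 0 ≤ (inner ℝ (H w) w : ℝ)) (hT : ∀ w, T.starProjection (H w) = H w) {γ : ℝ}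
    (hγ : 0 < γ) :
    (ContinuousLinearMap.id ℝ (Eucl n) + γ • (H ∘L T.starProjection)).IsInvertible := by
  refine isInvertible_of_forall_eq_zero fun w hw => ?_
  have h1 : w = -(γ • H (T.starProjection w)) := eq_neg_of_add_eq_zero_left hw
  have h2 : T.starProjection w = w := by
    conv_lhs => rw [h1]
    rw [map_neg, map_smul, hT, ← h1]
  rw [h2] at h1
  have h3 : (inner ℝ w w : ℝ) = -(γ * inner ℝ (H w) w) := by
    conv_lhs => rw [h1]
    rw [inner_neg_left, real_inner_smul_left, ← h1]
  have h4 := mul_nonneg hγ.le (hH w)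
  exact inner_self_eq_zero (𝕜 := ℝ) |>.1 (le_antisymm (by linarith) real_inner_self_nonneg)

/-- The Lipschitz bound gives `‖γ H_F w‖ ≤ γL‖w‖`, which is a strict contraction. -/
lemma isInvertible_GF {F : Eucl n → ℝ} {M : Set (Eucl n)} {x : Eucl n} {L : ℝ≥0}
    (hF : LipschitzWith L (gradient F)) {γ : ℝ} (hγ : 0 < γ) (hγL : γ * L < 1) :
    (GF γ F M x).IsInvertible := by
  refine isInvertible_of_forall_eq_zero fun w hw => ?_
  have h1 : w = γ • HF F M x w := sub_eq_zero.1 hw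
  have hP : ∀ v, ‖tangentProj M x v‖ ≤ ‖v‖ := fun v =>
    (tangentSpaceAt M x).norm_starProjection_apply_le v
  have h2 : ‖HF F M x w‖ ≤ L * ‖w‖ :=
    calc ‖HF F M x w‖ ≤ ‖fderiv ℝ (gradient F) x (tangentProj M x w)‖ := hP _
      _ ≤ ‖fderiv ℝ (gradient F) x‖ * ‖tangentProj M x w‖ := ContinuousLinearMap.le_opNorm _ _
      _ ≤ L * ‖w‖ := mul_le_mul (norm_fderiv_le_of_lipschitz ℝ hF) (hP w) (norm_nonneg _) L.2
  have h3 : ‖w‖ ≤ γ * L * ‖w‖ := by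
    conv_lhs => rw [h1]
    rw [norm_smul, Real.norm_of_nonneg hγ.le, mul_assoc]
    exact mul_le_mul_of_nonneg_left h2 hγ.le
  by_contra hne
  have := norm_pos_iff.2 hne
  nlinarith

/-! ### Linearisation of the iteration -/

lemma isLittleO_smul_of_tendsto {a : ℕ → ℝ} {z : ℕ → Eucl n} {N : ℕ → ℝ}
    (ha : Tendsto a atTop (𝓝 0)) (hz : z =O[atTop] N) : (fun k => a k • z k) =o[atTop] N := by
  simpa using ((isLittleO_one_iff ℝ).2 ha).smul_isBigO hz

/-- On `M` this is the first-order expansion of `Ψ = id`, with `DΨ(x) = P_T`. -/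
lemma IsLocalRetraction.sub_proj_isLittleO {M : Set (Eucl n)} {x : Eucl n}
    {T : Submodule ℝ (Eucl n)} {Ψ : Eucl n → Eucl n} (h : IsLocalRetraction M x T Ψ) :
    (fun y => (y - x) - T.starProjection (y - x)) =o[𝓝[M] x] fun y => y - x := by
  have h1 := h.eventually_hasFDerivAt.self_of_nhds.hasFDerivWithinAt (s := M)
  refine h1.isLittleO.congr' ?_ EventuallyEq.rfl
  filter_upwards [self_mem_nhdsWithin, nhdsWithin_le_nhds h.eventually_fix] with y hy hfix
  rw [hfix hy, h.map_self, h.fderiv_self]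

/-- Absorption: `‖b‖ ≤ C‖S‖ + ½(‖S‖ + ‖b‖)` gives `‖b‖ ≤ (2C + 1)‖S‖`. -/
lemma isBigO_of_sub_isLittleO_add {α : Type*} {l : Filter α} {b p : α → Eucl n} {S : α → ℝ}
    (hp : p =O[l] S) (h : (fun k => b k - p k) =o[l] fun k => ‖S k‖ + ‖b k‖) : b =O[l] S := by
  obtain ⟨C, hC⟩ := hp.bound
  refine IsBigO.of_bound (2 * C + 1) ?_
  filter_upwards [hC, h.bound (show (0 : ℝ) < 1 / 2 by norm_num)] with k h1 h2
  rw [Real.norm_of_nonneg (by positivity)] at h2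
  have := norm_le_norm_add_norm_sub' (b k) (p k)
  linarith

/-- The linearised recursion, with the error measured against the current and the next iterate. -/
lemma linearized_step {T : Submodule ℝ (Eucl n)} {H D : Eucl n →L[ℝ] Eucl n}
    {K : ℕ → Eucl n →L[ℝ] Eucl n} {γs : ℕ → ℝ} {γ : ℝ} {a b e f g : ℕ → Eucl n} {N : ℕ → ℝ}
    (hγ : Tendsto γs atTop (𝓝 γ)) (hK : Tendsto K atTop (𝓝 T.starProjection))
    (ha : a =O[atTop] N) (hb : b =O[atTop] N) (he : e =O[atTop] N)
    (hf : (fun k => f k - D (a k)) =o[atTop] N) (hg : (fun k => g k - H (b k)) =o[atTop] N)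
    (haT : (fun k => a k - T.starProjection (a k)) =o[atTop] N)
    (hbT : (fun k => b k - T.starProjection (b k)) =o[atTop] N)
    (heq : ∀ᶠ k in atTop, γs k • g k = K k (a k - b k - γs k • f k - γs k • e k)) :
    (fun k => (b k + γ • H (T.starProjection (b k))) -
      (a k - γ • T.starProjection (D (T.starProjection (a k))) - γ • T.starProjection (e k)))
      =o[atTop] N := by
  have hO : ∀ (A : Eucl n →L[ℝ] Eucl n) {z : ℕ → Eucl n}, z =O[atTop] N →
      (fun k => A (z k)) =O[atTop] N := fun A z hz => (A.isBigO_comp z atTop).trans hz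
  have ho : ∀ (A : Eucl n →L[ℝ] Eucl n) {z : ℕ → Eucl n}, z =o[atTop] N →
      (fun k => A (z k)) =o[atTop] N := fun A z hz => (A.isBigO_comp z atTop).trans_isLittleO hz
  have hγ0 : Tendsto (fun k => γs k - γ) atTop (𝓝 0) := by simpa using hγ.sub_const γ
  have hγO : γs =O[atTop] fun _ => (1 : ℝ) := hγ.isBigO_one ℝ
  have hfO : f =O[atTop] N := by simpa using hf.isBigO.add (hO D ha)
  have hgO : g =O[atTop] N := by simpa using hg.isBigO.add (hO H hb)
  have hsO : ∀ {z : ℕ → Eucl n}, z =O[atTop] N → (fun k => γs k • z k) =O[atTop] N :=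
    fun hz => by simpa using hγO.smul hz
  have hu := ((ha.sub hb).sub (hsO hfO)).sub (hsO he)
  have hKu := isLittleO_clm_apply (A := fun k => K k - T.starProjection)
    (by simpa using hK.sub_const T.starProjection) hu
  have h1 := ((isLittleO_smul_of_tendsto hγ0 hgO).add (hg.const_smul_left γ)).add
    ((ho H hbT).const_smul_left γ)
  have h2 := ((isLittleO_smul_of_tendsto hγ0 (hO T.starProjection hfO)).add
    ((ho T.starProjection hf).const_smul_left γ)).add
    ((ho (T.starProjection ∘L D) haT).const_smul_left γ)
  have h3 := isLittleO_smul_of_tendsto hγ0 (hO T.starProjection he)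
  -- Each replacement costs `o(N)`: `b` and `a` by their projections, `K k` by `P_T`, `γs k` by `γ`,
  -- `g` by `H b`, `f` by `D a`.
  refine (((((hbT.sub haT).add hKu).sub h1).sub h2).sub h3).congr' ?_ EventuallyEq.rfl
  filter_upwards [heq] with k hk
  simp only [_root_.sub_apply, ContinuousLinearMap.comp_apply, map_sub, map_smul,
    Pi.smul_apply] at hk ⊢
  have hKb : K k (b k) = K k (a k) - γs k • K k (f k) - γs k • K k (e k) - γs k • g k := by
    rw [hk]
    abel
  rw [hKb]
  module

/-- Any sequence close to a linear recursion can be written as a perturbed linear recursion. -/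
lemma exists_perturbed_recursion {a e d : ℕ → Eucl n} (B : Eucl n ≃L[ℝ] Eucl n)
    {Q : Eucl n →L[ℝ] Eucl n}
    (hd : (fun k => d (k + 1) - (B (a k) + Q (e k))) =o[atTop] fun k => ‖a k‖ + ‖e k‖) :
    ∃ d' φ : ℕ → Eucl n, (fun k => d' k - a k) =o[atTop] a ∧
      (fun k => φ k - Q (e k)) =o[atTop] e ∧ ∀ k, d (k + 1) = B (d' k) + φ k := by
  set τ : ℕ → Eucl n := fun k => d (k + 1) - (B (a k) + Q (e k)) with hτ
  -- The remainder `τ` is split in proportion to `‖e‖` and `‖a‖`, so that each share is small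
  -- relative to its own term. The share of `a` is pulled back through `B⁻¹`.
  let φ : ℕ → Eucl n := fun k => Q (e k) + (‖e k‖ / (‖a k‖ + ‖e k‖)) • τ k
  refine ⟨fun k => B.symm (d (k + 1) - φ k), φ, ?_, ?_, fun k => by simp⟩
  · have h1 : (fun k => τ k - (‖e k‖ / (‖a k‖ + ‖e k‖)) • τ k) =o[atTop] a := by
      refine IsLittleO.of_bound fun c hc => ?_
      filter_upwards [hd.bound hc] with k hk
      rw [Real.norm_of_nonneg (by positivity)] at hk
      rcases (add_nonneg (norm_nonneg (a k)) (norm_nonneg (e k))).eq_or_lt with h0 | h0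
      · rw [← h0, mul_zero, norm_le_zero_iff] at hk
        rw [hk, smul_zero, sub_zero, norm_zero]
        positivity
      · have h2 : τ k - (‖e k‖ / (‖a k‖ + ‖e k‖)) • τ k = (‖a k‖ / (‖a k‖ + ‖e k‖)) • τ k := by
          rw [eq_comm, ← one_smul ℝ (τ k), smul_smul, smul_smul, ← sub_smul]
          congr 1
          field_simp
          ring
        rw [h2, norm_smul, Real.norm_of_nonneg (by positivity)]
        calc _ ≤ ‖a k‖ / (‖a k‖ + ‖e k‖) * (c * (‖a k‖ + ‖e k‖)) := by gcongr
          _ = c * ‖a k‖ := by field_simp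
    refine (((B.symm : Eucl n →L[ℝ] Eucl n).isBigO_comp _ atTop).trans_isLittleO h1).congr_left
      fun k => ?_
    have h3 : τ k - (‖e k‖ / (‖a k‖ + ‖e k‖)) • τ k = (d (k + 1) - φ k) - B (a k) := by
      simp only [φ, hτ]
      abel
    rw [h3, map_sub]
    simp
  · refine IsLittleO.of_bound fun c hc => ?_
    filter_upwards [hd.bound hc] with k hk
    rw [Real.norm_of_nonneg (by positivity)] at hk
    simp only [φ, add_sub_cancel_left]
    rw [norm_smul, Real.norm_of_nonneg (by positivity)]
    rcases (add_nonneg (norm_nonneg (a k)) (norm_nonneg (e k))).eq_or_lt with h0 | h0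
    · rw [← h0, div_zero, zero_mul]
      positivity
    · calc _ ≤ ‖e k‖ / (‖a k‖ + ‖e k‖) * (c * (‖a k‖ + ‖e k‖)) := by gcongr
        _ = c * ‖e k‖ := by field_simp

/-- Local linearisation of the perturbed Forward--Backward iteration, along one trajectory. -/
lemma forwardBackward_linearization {R : Eucl n → EReal} {M : Set (Eucl n)} {xs : Eucl n}
    {F : Eucl n → ℝ} (hps : PartlySmooth R M xs) (hR : IsProperFun R) (hRc : IsConvexFun R)
    (hF : ContDiffAt ℝ 2 F xs) (hsub : -gradient F xs ∈ subdifferential R xs) {γs : ℕ → ℝ}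
    (hγs : ∀ k, 0 < γs k) {γ : ℝ} (hγ : Tendsto γs atTop (𝓝 γ))
    (hW : (ContinuousLinearMap.id ℝ (Eucl n) + γ • HR R F M xs).IsInvertible)
    {x e : ℕ → Eucl n}
    (hprox : ∀ k, IsProx (γs k) R (x k - γs k • (gradient F (x k) + e k)) (x (k + 1)))
    (hx : Tendsto x atTop (𝓝 xs)) (hM : ∀ᶠ k in atTop, x k ∈ M) :
    (fun k => (x (k + 1) - xs) -
      (MFB γ R F M xs (x k - xs) + -(γ • WR γ R F M xs (tangentProj M xs (e k)))))
      =o[atTop] (fun k => ‖x k - xs‖ + ‖e k‖) ∧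
    (fun k => x (k + 1) - xs) =O[atTop] fun k => ‖x k - xs‖ + ‖e k‖ := by
  obtain ⟨T, Ψ, h⟩ := hps.manifold.exists_isLocalRetraction
  obtain rfl := h.tangentSpaceAt_self
  obtain ⟨G, hG, hRG⟩ := hps.smooth
  have hHR := HR_eq h hG hRG hF hsub
  set c := gradient F xs
  set q := tiltedPullback G Ψ c
  set H := fderiv ℝ (gradient q) xs
  have hq : ContDiffAt ℝ 2 q xs := h.contDiffAt_tiltedPullback hG
  have hq0 : gradient q xs = 0 := by
    refine ext_inner_right ℝ fun w => ?_
    rw [inner_gradient, (h.isLocalMin_tiltedPullback hRG hsub).fderiv_eq_zero, inner_zero_left]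
    rfl
  have hx1 : Tendsto (fun k => x (k + 1)) atTop (𝓝 xs) := hx.comp (tendsto_add_atTop_nat 1)
  have hxM : Tendsto x atTop (𝓝[M] xs) := tendsto_nhdsWithin_iff.2 ⟨hx, hM⟩
  have hx1M : Tendsto (fun k => x (k + 1)) atTop (𝓝[M] xs) := hxM.comp (tendsto_add_atTop_nat 1)
  let S : ℕ → ℝ := fun k => ‖x k - xs‖ + ‖e k‖
  -- The expansion of `∇q` is taken at `x_{k+1}`, so the error is first measured with the next
  -- iterate included; `hbS` removes it below.
  let N : ℕ → ℝ := fun k => ‖S k‖ + ‖x (k + 1) - xs‖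
  have hS : ∀ k, ‖S k‖ = ‖x k - xs‖ + ‖e k‖ := fun k => Real.norm_of_nonneg (by positivity)
  have hbound : ∀ {z : ℕ → Eucl n} {s : ℕ → ℝ}, (∀ k, ‖z k‖ ≤ ‖s k‖) → z =O[atTop] s :=
    fun hz => IsBigO.of_bound 1 (Eventually.of_forall fun k => by rw [one_mul]; exact hz k)
  have haS : (fun k => x k - xs) =O[atTop] S := hbound fun k => by
    rw [hS]; linarith [norm_nonneg (e k)]
  have heS : e =O[atTop] S := hbound fun k => by
    rw [hS]; linarith [norm_nonneg (x k - xs)]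
  have hN : ∀ k, ‖N k‖ = ‖S k‖ + ‖x (k + 1) - xs‖ := fun k => Real.norm_of_nonneg (by positivity)
  have hSN : S =O[atTop] N := IsBigO.of_bound 1 (Eventually.of_forall fun k => by
    rw [one_mul, hN]; linarith [norm_nonneg (x (k + 1) - xs)])
  have hbN : (fun k => x (k + 1) - xs) =O[atTop] N := hbound fun k => by
    rw [hN]; linarith [norm_nonneg (S k)]
  have haN := haS.trans hSN
  have hstep := linearized_step (H := H) (D := fderiv ℝ (gradient F) xs)
    (f := fun k => gradient F (x k) - c) (g := fun k => gradient q (x (k + 1)))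
    (K := fun k => adjDeriv Ψ (x (k + 1))) hγ
    (by
      have := h.continuousAt_adjDeriv.tendsto.comp hx1
      rwa [h.adjDeriv_self] at this)
    haN hbN (heS.trans hSN)
    (((hasFDerivAt_gradient hF).isLittleO.comp_tendsto hx).trans_isBigO haN)
    ((((hasFDerivAt_gradient hq).isLittleO.comp_tendsto hx1).trans_isBigO hbN).congr_left
      fun k => by simp [hq0, H])
    ((h.sub_proj_isLittleO.comp_tendsto hxM).trans_isBigO haN)
    ((h.sub_proj_isLittleO.comp_tendsto hx1M).trans_isBigO hbN)
    (by
      filter_upwards [hx1.eventually (h.gradient_tiltedPullback_eq_of_mem_subdifferential hG hRG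
        (c := c)), hx1M.eventually self_mem_nhdsWithin] with k hk hkM
      rw [hk hkM _ (forwardBackward_mem_subdifferential hR hRc (hγs k) (hprox k)), ← map_smul]
      congr 1
      rw [smul_add, smul_sub, smul_sub, smul_smul, mul_inv_cancel₀ (hγs k).ne', one_smul, smul_sub]
      abel)
  obtain ⟨W, hWe⟩ := hW
  have hWR : WR γ R F M xs = (W.symm : Eucl n →L[ℝ] Eucl n) := by
    rw [WR, ← hWe, ContinuousLinearMap.inverse_equiv]
  have hres : (fun k => (x (k + 1) - xs) -
      (MFB γ R F M xs (x k - xs) + -(γ • WR γ R F M xs (tangentProj M xs (e k))))) =o[atTop] N := by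
    refine (((W.symm : Eucl n →L[ℝ] Eucl n).isBigO_comp _ atTop).trans_isLittleO hstep).congr_left
      fun k => ?_
    have h1 : (x (k + 1) - xs) + γ • H ((tangentSpaceAt M xs).starProjection (x (k + 1) - xs)) =
        W (x (k + 1) - xs) := by
      have := congrArg (fun A : Eucl n →L[ℝ] Eucl n => A (x (k + 1) - xs)) hWe
      rw [hHR] at this
      exact this.symm
    rw [h1, map_sub]
    simp only [MFB, GF, HF, hWR, tangentProj, ContinuousLinearMap.comp_apply, _root_.sub_apply,
      ContinuousLinearEquiv.coe_coe, ContinuousLinearEquiv.symm_apply_apply, map_sub, map_smul,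
      ContinuousLinearMap.id_apply, _root_.smul_apply]
    module
  have hpO : (fun k => MFB γ R F M xs (x k - xs) +
      -(γ • WR γ R F M xs (tangentProj M xs (e k)))) =O[atTop] S :=
    (((MFB γ R F M xs).isBigO_comp _ atTop).trans haS).add
      (((((WR γ R F M xs ∘L tangentProj M xs).isBigO_comp e atTop).trans heS).const_smul_left
        γ).neg_left)
  have hbS := isBigO_of_sub_isLittleO_add hpO hres
  have hNS : N =O[atTop] S := (isBigO_refl S _).norm_left.add hbS.norm_left
  exact ⟨hres.trans_isBigO hNS, hbS⟩

lemma isInvertible_id_add_smul_HR {R : Eucl n → EReal} {M : Set (Eucl n)} {xs : Eucl n}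
    {F : Eucl n → ℝ} (hps : PartlySmooth R M xs) (hF : ContDiffAt ℝ 2 F xs)
    (hsub : -gradient F xs ∈ subdifferential R xs) {γ : ℝ} (hγ : 0 < γ) :
    (ContinuousLinearMap.id ℝ (Eucl n) + γ • HR R F M xs).IsInvertible := by
  obtain ⟨T, Ψ, h⟩ := hps.manifold.exists_isLocalRetraction
  obtain rfl := h.tangentSpaceAt_self
  obtain ⟨G, hG, hRG⟩ := hps.smooth
  rw [HR_eq h hG hRG hF hsub]
  exact isInvertible_id_add_smul_comp_proj
    (fderiv_gradient_nonneg_of_isLocalMin (h.contDiffAt_tiltedPullback hG)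
      (h.isLocalMin_tiltedPullback hRG hsub))
    (h.proj_fderiv_gradient_tiltedPullback hG) hγ

end PerturbedFB

/-! ### The theorem, trajectory by trajectory -/

theorem proposition4p5 {n m : ℕ} (hm : 0 < m)
    -- the problem `min R + F`, `F = (1/m) ∑ᵢ fᵢ`, with `L = maxᵢ Lᵢ`
    (R : PerturbedFB.Eucl n → EReal) (f : Fin m → PerturbedFB.Eucl n → ℝ) (Li : Fin m → ℝ≥0)
    (hR_proper : PerturbedFB.IsProperFun R) (hR_convex : PerturbedFB.IsConvexFun R)
    (hR_lsc : LowerSemicontinuous R)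
    (hf : ∀ i, ContDiff ℝ 1 (f i)) (hf_lip : ∀ i, LipschitzWith (Li i) (gradient (f i)))
    -- the perturbed Forward--Backward iteration
    {Ω : Type*} [MeasurableSpace Ω] (P : Measure Ω) [IsProbabilityMeasure P]
    (γs : ℕ → ℝ) (hγs : ∀ k, 0 < γs k)
    (X ε : ℕ → Ω → PerturbedFB.Eucl n)
    (hX : ∀ᵐ ω ∂P, ∀ k, PerturbedFB.IsProx (γs k) R
      (X k ω - γs k • (gradient (PerturbedFB.average f) (X k ω) + ε k ω)) (X (k + 1) ω))
    -- step-sizes bounded away from zero, vanishing errors, convergence to a minimiser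
    (hγs_liminf : ∃ γlow : ℝ, 0 < γlow ∧
      (γlow : EReal) ≤ liminf (fun k => ((γs k : ℝ) : EReal)) atTop)
    (hε : ∀ᵐ ω ∂P, Tendsto (fun k => ε k ω) atTop (𝓝 0))
    (xs : PerturbedFB.Eucl n)
    (hxs : IsMinOn (PerturbedFB.objective R (PerturbedFB.average f)) Set.univ xs)
    (hX_lim : ∀ᵐ ω ∂P, Tendsto (fun k => X k ω) atTop (𝓝 xs))
    -- partial smoothness and non-degeneracy at the limit
    (M : Set (PerturbedFB.Eucl n)) (hps : PerturbedFB.PartlySmooth R M xs)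
    (hnd : -gradient (PerturbedFB.average f) xs ∈
      intrinsicInterior ℝ (PerturbedFB.subdifferential R xs)) :
    (∀ᵐ ω ∂P, Tendsto (fun k => X k ω) atTop (𝓝 xs) ∧ ∃ K : ℕ, ∀ k ≥ K, X k ω ∈ M) ∧
    (ContDiffAt ℝ 2 (PerturbedFB.average f) xs →
      ∀ γ : ℝ, Tendsto γs atTop (𝓝 γ) → 0 < γ → γ * (Finset.univ.sup Li : ℝ≥0) < 1 →
        (ContinuousLinearMap.id ℝ (PerturbedFB.Eucl n) +
          γ • PerturbedFB.HR R (PerturbedFB.average f) M xs).IsInvertible ∧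
        ∀ᵐ ω ∂P, ∃ K : ℕ,
          -- for every sequence `d` of the form `x_k - x⋆ + o(‖x_k - x⋆‖)` on the left-hand side ...
          ∀ d : ℕ → PerturbedFB.Eucl n,
            (fun k => d k - (X k ω - xs)) =o[atTop] (fun k => X k ω - xs) →
            -- ... there is one on the right-hand side, and a `φ` of the form
            -- `-γ W_R P_T ε_k + o(‖ε_k‖)`
            ∃ d' φ : ℕ → PerturbedFB.Eucl n,
              (fun k => d' k - (X k ω - xs)) =o[atTop] (fun k => X k ω - xs) ∧
              (fun k => φ k - (-(γ • PerturbedFB.WR γ R (PerturbedFB.average f) M xs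
                (PerturbedFB.tangentProj M xs (ε k ω))))) =o[atTop] (fun k => ε k ω) ∧
              ∀ k ≥ K, d (k + 1) =
                PerturbedFB.MFB γ R (PerturbedFB.average f) M xs (d' k) + φ k) := by

  have hlow := PerturbedFB.exists_pos_eventually_le_of_le_liminf hγs_liminf
  have hlip := PerturbedFB.lipschitzWith_gradient_average hm hf hf_lip
  have hsub := intrinsicInterior_subset hnd
  have hmem : ∀ᵐ ω ∂P, ∀ᶠ k in atTop, X k ω ∈ M := by
    filter_upwards [hX, hε, hX_lim] with ω h1 h2 h3
    exact PerturbedFB.forwardBackward_eventually_mem hps hR_proper hR_convex hlip.continuous hnd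
      hγs hlow h1 h2 h3
  refine ⟨?_, fun hF γ hγ hγ0 hγL => ?_⟩
  · filter_upwards [hX_lim, hmem] with ω h1 h2
    exact ⟨h1, eventually_atTop.1 h2⟩
  have hW := PerturbedFB.isInvertible_id_add_smul_HR hps hF hsub hγ0
  refine ⟨hW, ?_⟩
  filter_upwards [hX, hX_lim, hmem] with ω h1 h2 h3
  obtain ⟨hres, hbS⟩ := PerturbedFB.forwardBackward_linearization hps hR_proper hR_convex hF hsub
    hγs hγ hW (x := fun k => X k ω) (e := fun k => ε k ω) h1 h2 h3
  obtain ⟨W, hWe⟩ := hW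
  obtain ⟨A, hA⟩ := PerturbedFB.isInvertible_GF (M := M) (x := xs) hlip hγ0 hγL
  have hB : PerturbedFB.MFB γ R (PerturbedFB.average f) M xs =
      (A.trans W.symm : PerturbedFB.Eucl n ≃L[ℝ] PerturbedFB.Eucl n) := by
    rw [PerturbedFB.MFB, PerturbedFB.WR, ← hWe, ContinuousLinearMap.inverse_equiv, ← hA]
    rfl
  -- `K = 0` works: invertibility of `M_FB` lets `d'` solve the recursion exactly at every index,
  -- and only the Landau estimates are asymptotic.
  refine ⟨0, fun d hd => ?_⟩
  -- The error `o(‖x_{k+1} - x⋆‖)` of the given `d` is also `o(‖x_k - x⋆‖ + ‖ε_k‖)` and joins the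
  -- remainder.
  have hd1 : (fun k => d (k + 1) - (X (k + 1) ω - xs)) =o[atTop]
      fun k => ‖X k ω - xs‖ + ‖ε k ω‖ :=
    (hd.comp_tendsto (tendsto_add_atTop_nat 1)).trans_isBigO hbS
  obtain ⟨d', φ, hd', hφ, heq⟩ := PerturbedFB.exists_perturbed_recursion
    (a := fun k => X k ω - xs) (e := fun k => ε k ω) (d := d) (A.trans W.symm)
    (Q := -(γ • (PerturbedFB.WR γ R (PerturbedFB.average f) M xs ∘L
      PerturbedFB.tangentProj M xs)))
    ((hd1.add hres).congr_left fun k => by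
      rw [sub_add_sub_cancel, hB]
      rfl)
  refine ⟨d', φ, hd', hφ, fun k _ => ?_⟩
  rw [heq k, hB]
  rfl
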